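/- For a real random variable $Y$ let $\|Y\|_{\psi_2}=\inf\{t>0:\ \mathbb{E}\exp(Y^2/t^2)\le 2\}\in[0,\infty]$ be its subgaussian norm. Let $K\ge 0$. For positive integers $n,d$, a *simple subgaussian random tensor* (with constant $K$) is a random tensor $X=x_1\otimes\cdots\otimes x_d$ in $\mathbb{R}^{n^d}$, where $x_1,\dots,x_d$ are independent random vectors in $\mathbb{R}^n$, each of which has independent coordinates with mean zero, unit variance and subgaussian norm at most $K$. The space $\mathbb{R}^{n^d}$ carries the Euclidean norm $\|\cdot\|_2$. **Corollary 6.2 (Random tensors are well conditioned; informal version Corollary 1.5).** (i) There are constants $C,c>0$ that depend only on $K$ such that the following holds. Let $n,d\ge 1$ and $m\ge 0$ be integers and let $\varepsilon$ be a real number with $$\frac{Cd^2\log n}{n}\le\varepsilon\le\frac12 \qquad\text{and}\qquad m\le(1-\varepsilon)n^d .$$ Let $X_1,\dots,X_m$ be independent (not necessarily identically distributed) simple subgaussian random tensors in $\mathbb{R}^{n^d}$ with constant $K$. Then, with probability at least $1-2\exp(-c\varepsilon n/d)$, $$\Big\|\sum_{i=1}^m a_iX_i\Big\|_2\ \ge\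 \frac{\sqrt{\varepsilon}}{2}\,\|a\|_2\qquad\text{for all } a=(a_1,\dots,a_m)\in\mathbb{R}^m .$$ (ii) Consequently, the smallest singular value is bounded below by a constant when $d=o(\sqrt{n/\log n})$: let $\varepsilon\in(0,1)$, let $d=d(n)\ge 1$ be integers with $d(n)=o(\sqrt{n/\log n})$ as $n\to\infty$, and let $\delta>0$. Then for all sufficiently large $n$ (depending only on $K$, $\varepsilon$, $\delta$ and the sequence $d(\cdot)$), all integers $1\le m\le(1-\varepsilon)n^{d}$ and all independent simple subgaussian random tensors $X_1,\dots,X_m$ in $\mathbb{R}^{n^{d}}$ with constant $K$, the $n^{d}\times m$ (Khatri–Rao) matrix with columns $X_1,\dots,X_m$ has smallest singular value at least $\sqrt{\varepsilon}/2$ with probability at least $1-\delta$. -/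

import Mathlib

open MeasureTheory ProbabilityTheory Filter Topology Asymptotics
open scoped NNReal ENNReal

noncomputable section

/-- The subgaussian norm `‖Y‖_ψ₂ = inf {t > 0 : 𝔼 exp (Y² / t²) ≤ 2}` of a real random variable,
with value `∞` when no such `t` exists (that is, when `Y` is not subgaussian). -/
def psi2Norm {Ω : Type*} [MeasurableSpace Ω] (μ : Measure Ω) (Y : Ω → ℝ) : ℝ≥0∞ :=
  ⨅ t ∈ {t : ℝ | 0 < t ∧ ∫⁻ ω, ENNReal.ofReal (Real.exp (Y ω ^ 2 / t ^ 2)) ∂μ ≤ 2},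
    ENNReal.ofReal t

/-- The space `ℝ^(n^d)` of real tensors of degree `d` over `ℝⁿ`, with its Euclidean norm. -/
abbrev TensorSpace (d n : ℕ) : Type := EuclideanSpace ℝ (Fin d → Fin n)

/-- The simple tensor `x₁ ⊗ ⋯ ⊗ x_d`, whose `(j₁, …, j_d)` coefficient is
`x₁(j₁) ⋯ x_d(j_d)`. -/
def simpleTensor {d n : ℕ} (x : Fin d → EuclideanSpace ℝ (Fin n)) : TensorSpace d n :=
  WithLp.toLp 2 fun j => ∏ k, x k (j k)

/-- `X` is a simple subgaussian random tensor: `X = x₁ ⊗ ⋯ ⊗ x_d` for independent random vectors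
`x₁, …, x_d` in `ℝⁿ`, each with independent, mean zero, unit variance, subgaussian coordinates.
The number `K` bounds the subgaussian norms of the coordinates. -/
def IsSimpleSubgaussianTensor {Ω : Type*} [MeasurableSpace Ω] (μ : Measure Ω) (K : ℝ≥0) {d n : ℕ}
    (X : Ω → TensorSpace d n) : Prop :=
  ∃ x : Fin d → Ω → EuclideanSpace ℝ (Fin n),
    (∀ k, Measurable (x k)) ∧
    iIndepFun x μ ∧
    (∀ k, iIndepFun (fun (j : Fin n) (ω : Ω) => x k ω j) μ) ∧
    (∀ k j, ∫ ω, x k ω j ∂μ = 0) ∧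
    (∀ k j, variance (fun ω => x k ω j) μ = 1) ∧
    (∀ k j, psi2Norm μ (fun ω => x k ω j) ≤ K) ∧
    ∀ ω, X ω = simpleTensor fun k => x k ω

/-- The `n^d × m` matrix whose columns are the (vectorized) tensors `X₁, …, X_m`. -/
def khatriRao {d n m : ℕ} (X : Fin m → TensorSpace d n) : Matrix (Fin d → Fin n) (Fin m) ℝ :=
  Matrix.of fun j i => X i j

/-- The smallest singular value of a real matrix with `m ≥ 1` columns (and at least as many rows):
the last of the `m` singular values, which Mathlib lists in decreasing order starting from
index `0`. -/
def sigmaMin {ι : Type*} [Fintype ι] {m : ℕ} (A : Matrix ι (Fin m) ℝ) : ℝ :=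
  (Matrix.toEuclideanLin A).singularValues (m - 1)

end

/-! Suppose some combination of the `X_i` has norm below `(√ε/2)‖a‖`. Dividing by the largest
coefficient puts one column within `(√ε/2)√m` of the span of the others (`exists_norm_sub_sum_lt`).
By independence those others may be frozen. Let `P` be the orthogonal projection onto the complement
of their span. Its rank is at least `n^d - m ≥ ε n^d`, so `‖P X‖²` has mean at least `ε n^d`, and
the bad event forces it below `ε n^d / 4`. What is needed is a lower tail bound for `‖P X‖²` with
`X` a simple tensor, followed by a union bound over the columns.

The lower tail comes from the exponential moment of `-λ‖P X‖²`, integrating out one factor at a time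
(`lintegral_controlledTails_exp_neg_gramForm_le`). Given the other factors, `‖P X‖²` is a positive
semidefinite form in `x₁`. A one-sided Hanson–Wright inequality (`lintegral_exp_neg_quadForm_le`)
replaces this form by its trace, at the price of shrinking `λ` to `λ(1 - Dλκ)`, where `κ` bounds the
operator norm. The trace is again a sum of squared functionals, now of a tensor of degree one less,
so the argument iterates. With `λ` of order `1/(dDκ)` the `d` losses multiply to a constant.

The bound `κ` requires the product of the squared norms of the remaining factors to stay within a
factor `e` of its mean. This holds off a small event by a Chernoff bound
(`measure_compl_controlledTails_le`), so the moments are taken on that event only. Both failures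
have probability `exp(-cεn/d)` up to a factor `d`. Since `εn/d ≥ C d log n`, this absorbs the union
bound over at most `n^d` columns. -/

/-! ### One-dimensional subgaussian laws and their exponential moments. -/

/-- A centred law of unit variance on the line whose subgaussian norm is at most `L`. -/
structure IsUnitSubgaussian (L : ℝ) (ν : Measure ℝ) : Prop where
  prob : IsProbabilityMeasure ν
  memLp : MemLp id 2 ν
  mean : ∫ x, x ∂ν = 0
  sq : ∫ x, x ^ 2 ∂ν = 1
  exp_sq : ∫⁻ x, ENNReal.ofReal (Real.exp (x ^ 2 / L ^ 2)) ∂ν ≤ 2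

namespace IsUnitSubgaussian

variable {L : ℝ} {ν : Measure ℝ}

lemma integrable_id (h : IsUnitSubgaussian L ν) : Integrable (fun x : ℝ => x) ν := by
  have := h.prob
  exact h.memLp.integrable (by norm_num)

lemma integrable_sq (h : IsUnitSubgaussian L ν) : Integrable (fun x : ℝ => x ^ 2) ν :=
  h.memLp.integrable_sq

lemma integrable_exp_sq (h : IsUnitSubgaussian L ν) :
    Integrable (fun x : ℝ => Real.exp (x ^ 2 / L ^ 2)) ν := by
  refine ⟨by fun_prop, ?_⟩
  rw [hasFiniteIntegral_iff_ofReal (Eventually.of_forall fun x => (Real.exp_pos _).le)]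
  exact h.exp_sq.trans_lt (by simp)

lemma integral_exp_sq_le (h : IsUnitSubgaussian L ν) :
    ∫ x, Real.exp (x ^ 2 / L ^ 2) ∂ν ≤ 2 := by
  rw [integral_eq_lintegral_of_nonneg_ae (Eventually.of_forall fun x => (Real.exp_pos _).le)
    (by fun_prop)]
  exact ENNReal.toReal_le_of_le_ofReal (by norm_num) (by simpa using h.exp_sq)

/-- Comparison of an exponential moment with `p₀ + p₁ x + p₂ x² + p₃ exp (x² / L²)`. -/
lemma lintegral_exp_le (h : IsUnitSubgaussian L ν) {g : ℝ → ℝ} {p₀ p₁ p₂ p₃ q : ℝ} (hp₃ : 0 ≤ p₃)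
    (hg : ∀ x, Real.exp (g x) ≤ p₀ + p₁ * x + p₂ * x ^ 2 + p₃ * Real.exp (x ^ 2 / L ^ 2))
    (hq : p₀ + p₂ + 2 * p₃ ≤ q) :
    ∫⁻ x, ENNReal.ofReal (Real.exp (g x)) ∂ν ≤ ENNReal.ofReal q := by
  have := h.prob
  have h₁ := h.integrable_id.const_mul p₁
  have h₂ := h.integrable_sq.const_mul p₂
  have h₃ := h.integrable_exp_sq.const_mul p₃
  have h₀ : Integrable (fun _ : ℝ => p₀) ν := integrable_const _
  have h₀₁ : Integrable (fun x : ℝ => p₀ + p₁ * x) ν := h₀.add h₁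
  have h₀₂ : Integrable (fun x : ℝ => p₀ + p₁ * x + p₂ * x ^ 2) ν := h₀₁.add h₂
  calc _ ≤ ∫⁻ x, ENNReal.ofReal
        (p₀ + p₁ * x + p₂ * x ^ 2 + p₃ * Real.exp (x ^ 2 / L ^ 2)) ∂ν :=
        lintegral_mono fun x => ENNReal.ofReal_le_ofReal (hg x)
    _ = ENNReal.ofReal
        (∫ x, (p₀ + p₁ * x + p₂ * x ^ 2 + p₃ * Real.exp (x ^ 2 / L ^ 2)) ∂ν) :=
        (ofReal_integral_eq_lintegral_ofReal (h₀₂.add h₃)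
          (Eventually.of_forall fun x => (Real.exp_pos _).le.trans (hg x))).symm
    _ ≤ ENNReal.ofReal q := by
        refine ENNReal.ofReal_le_ofReal ?_
        have e : ∫ x, (p₀ + p₁ * x + p₂ * x ^ 2 + p₃ * Real.exp (x ^ 2 / L ^ 2)) ∂ν
            = p₀ + p₂ + p₃ * ∫ x, Real.exp (x ^ 2 / L ^ 2) ∂ν := by
          rw [integral_add h₀₂ h₃, integral_add h₀₁ h₂,
            integral_add h₀ h₁, integral_const_mul, integral_const_mul, integral_const_mul,
            h.mean, h.sq]
          simp
        rw [e]
        nlinarith [h.integral_exp_sq_le]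

end IsUnitSubgaussian

lemma Real.exp_le_one_add_add_sq {u : ℝ} (hu : u ≤ 1) : Real.exp u ≤ 1 + u + u ^ 2 := by
  rcases le_or_gt (-1) u with h | h
  · have := Real.abs_exp_sub_one_sub_id_le (abs_le.2 ⟨h, hu⟩)
    linarith [le_abs_self (Real.exp u - 1 - u)]
  · have : Real.exp u ≤ 1 := Real.exp_le_one_iff.2 (by linarith)
    nlinarith

/-- Keeping the linear term outside the exponential lets it vanish under a centred law. -/
lemma Real.exp_le_add_exp_sq (u : ℝ) : Real.exp u ≤ u + Real.exp (u ^ 2) := by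
  rcases le_or_gt u 1 with h | h
  · linarith [Real.exp_le_one_add_add_sq h, Real.add_one_le_exp (u ^ 2)]
  · have : Real.exp u ≤ Real.exp (u ^ 2) := Real.exp_le_exp.2 (by nlinarith)
    linarith

lemma Real.exp_mul_le_of_le_one {s : ℝ} (h₀ : 0 ≤ s) (h₁ : s ≤ 1) (y : ℝ) :
    Real.exp (s * y) ≤ 1 - s + s * Real.exp y := by
  have := convexOn_exp.2 (Set.mem_univ (0 : ℝ)) (Set.mem_univ y) (sub_nonneg.2 h₁) h₀ (by ring)
  simpa using this

lemma Real.sq_le_two_mul_exp {y : ℝ} (hy : 0 ≤ y) : y ^ 2 ≤ 2 * Real.exp y := by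
  linarith [Real.quadratic_le_exp_of_nonneg hy]

namespace IsUnitSubgaussian

variable {L : ℝ} {ν : Measure ℝ}

/-- One coordinate of Hanson–Wright. Centring kills `b x`, unit variance turns `-a x²` into `-a`,
and all the rest is of second order in `(a, b)`. -/
lemma lintegral_exp_linear_sub_sq_le (hL : 0 < L) (h : IsUnitSubgaussian L ν) {a : ℝ} (ha : 0 ≤ a)
    (b : ℝ) :
    ∫⁻ x, ENNReal.ofReal (Real.exp (b * x - a * x ^ 2)) ∂ν ≤
      ENNReal.ofReal (Real.exp (-a + (3 + 2 * L ^ 2 + 8 * L ^ 4) * (a ^ 2 + b ^ 2))) := by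
  have hL2 : 0 < L ^ 2 := by positivity
  have hL4 : 0 < L ^ 4 := by positivity
  have hb2 := sq_nonneg b
  have ha2 := sq_nonneg a
  have m1 := mul_nonneg hL2.le ha2
  have m2 := mul_nonneg hL2.le hb2
  have m3 := mul_nonneg hL4.le ha2
  have m4 := mul_nonneg hL4.le hb2
  -- If `b² ≤ a`, the exponent is at most `1` and a quadratic expansion of `exp` applies. Otherwise
  -- `-a x²` is dropped, which costs only `a < b²`.
  rcases le_or_gt (b ^ 2) a with hab | hab
  · refine h.lintegral_exp_le (p₀ := 1) (p₁ := b) (p₂ := 2 * b ^ 2 - a) (p₃ := 4 * a ^ 2 * L ^ 4)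
      (by positivity) (fun x => ?_) ?_
    · have hx : b * x - a * x ^ 2 ≤ 1 := by nlinarith [sq_nonneg (b * x - 1), sq_nonneg x]
      have h1 := Real.exp_le_one_add_add_sq hx
      have h2 := Real.sq_le_two_mul_exp (y := x ^ 2 / L ^ 2) (by positivity)
      have h3 : x ^ 4 ≤ 2 * L ^ 4 * Real.exp (x ^ 2 / L ^ 2) := by
        have : x ^ 4 = L ^ 4 * (x ^ 2 / L ^ 2) ^ 2 := by field_simp
        rw [this]; nlinarith
      have h4 : (b * x - a * x ^ 2) ^ 2 ≤ 2 * b ^ 2 * x ^ 2 + 2 * a ^ 2 * x ^ 4 := by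
        nlinarith [sq_nonneg (b * x + a * x ^ 2)]
      nlinarith [mul_le_mul_of_nonneg_left h3 ha2]
    · refine le_trans ?_ (Real.add_one_le_exp _)
      nlinarith
  · have hle : ∀ x, Real.exp (b * x - a * x ^ 2) ≤ Real.exp (b * x) := fun x =>
      Real.exp_le_exp.2 (by nlinarith [sq_nonneg x])
    rcases le_or_gt (b ^ 2 * L ^ 2) 1 with hs | hs
    · refine h.lintegral_exp_le (p₀ := 1 - b ^ 2 * L ^ 2) (p₁ := b) (p₂ := 0)
        (p₃ := b ^ 2 * L ^ 2) (by positivity) (fun x => ?_) ?_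
      · have h1 := Real.exp_le_add_exp_sq (b * x)
        have h2 := Real.exp_mul_le_of_le_one (by positivity) hs (x ^ 2 / L ^ 2)
        have h3 : b ^ 2 * L ^ 2 * (x ^ 2 / L ^ 2) = (b * x) ^ 2 := by field_simp
        rw [h3] at h2
        linarith [hle x]
      · refine le_trans ?_ (Real.add_one_le_exp _)
        nlinarith
    -- For large `b`, Young's inequality suffices: the resulting factor `2` is at most `exp (b²
    -- L²)`.
    · refine h.lintegral_exp_le (p₀ := 0) (p₁ := 0) (p₂ := 0)
        (p₃ := Real.exp (b ^ 2 * L ^ 2 / 2)) (by positivity) (fun x => ?_) ?_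
      · refine (hle x).trans ?_
        rw [← Real.exp_add]
        have h3 : b ^ 2 * L ^ 2 / 2 + x ^ 2 / L ^ 2 - b * x
            = (b * L - x / L) ^ 2 / 2 + (x / L) ^ 2 / 2 := by field_simp; ring
        have h4 : b * x ≤ b ^ 2 * L ^ 2 / 2 + x ^ 2 / L ^ 2 := by
          rw [← sub_nonneg, h3]; positivity
        simpa using h4
      · have h5 : (2 : ℝ) ≤ Real.exp (b ^ 2 * L ^ 2) := by
          linarith [Real.add_one_le_exp (b ^ 2 * L ^ 2)]
        have h6 : 2 * Real.exp (b ^ 2 * L ^ 2 / 2) ≤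
            Real.exp (b ^ 2 * L ^ 2) * Real.exp (b ^ 2 * L ^ 2 / 2) := by gcongr
        rw [← Real.exp_add] at h6
        refine le_trans (by simpa using h6) (Real.exp_le_exp.2 ?_)
        nlinarith

/-- From `exp v ≤ 1 + v + v² exp v` with `v = θ x²`: half of `x² / L²` in the exponent pays for `exp
v`, the other half for `v²`. -/
lemma lintegral_exp_mul_sq_le (hL : 0 < L) (h : IsUnitSubgaussian L ν) {θ : ℝ} (hθ : 0 ≤ θ)
    (hθL : θ * (2 * L ^ 2) ≤ 1) :
    ∫⁻ x, ENNReal.ofReal (Real.exp (θ * x ^ 2)) ∂ν ≤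
      ENNReal.ofReal (Real.exp (θ + 16 * L ^ 4 * θ ^ 2)) := by
  have hL2 : 0 < L ^ 2 := by positivity
  refine h.lintegral_exp_le (p₀ := 1) (p₁ := 0) (p₂ := θ) (p₃ := 8 * L ^ 4 * θ ^ 2)
    (by positivity) (fun x => ?_) ?_
  · have hv : 0 ≤ θ * x ^ 2 := by positivity
    have h1 : Real.exp (θ * x ^ 2) ≤ 1 + θ * x ^ 2 + (θ * x ^ 2) ^ 2 * Real.exp (θ * x ^ 2) := by
      rcases le_or_gt (θ * x ^ 2) 1 with h1 | h1
      · have := Real.exp_le_one_add_add_sq h1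
        have := Real.one_le_exp hv
        nlinarith [sq_nonneg (θ * x ^ 2)]
      · have : 1 ≤ (θ * x ^ 2) ^ 2 := by nlinarith
        nlinarith [Real.exp_pos (θ * x ^ 2)]
    have hy : x ^ 2 = L ^ 2 * (x ^ 2 / L ^ 2) := by field_simp
    have h2 : θ * x ^ 2 ≤ x ^ 2 / L ^ 2 / 2 := by
      rw [div_div, le_div_iff₀ (by positivity)]
      nlinarith [sq_nonneg x]
    have h3 := Real.sq_le_two_mul_exp (y := x ^ 2 / L ^ 2 / 2) (by positivity)
    have h4 : (θ * x ^ 2) ^ 2 = 4 * L ^ 4 * θ ^ 2 * (x ^ 2 / L ^ 2 / 2) ^ 2 := by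
      field_simp; norm_num
    have h5 : (θ * x ^ 2) ^ 2 * Real.exp (θ * x ^ 2) ≤
        8 * L ^ 4 * θ ^ 2 * Real.exp (x ^ 2 / L ^ 2) := by
      have e : Real.exp (x ^ 2 / L ^ 2) =
          Real.exp (x ^ 2 / L ^ 2 / 2) * Real.exp (x ^ 2 / L ^ 2 / 2) := by
        rw [← Real.exp_add]; ring_nf
      calc _ ≤ (4 * L ^ 4 * θ ^ 2 * (2 * Real.exp (x ^ 2 / L ^ 2 / 2))) *
            Real.exp (x ^ 2 / L ^ 2 / 2) := by
              rw [h4]; gcongr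
        _ = _ := by rw [e]; ring
    linarith
  · refine le_trans (le_of_eq (by ring)) (Real.add_one_le_exp _)

end IsUnitSubgaussian

/-! ### Integration over finite products. -/

section PiIntegral

variable {α : Type*} [MeasurableSpace α]

/-- Tonelli with the first coordinate innermost: the inductions below integrate it out with the rest
frozen. -/
lemma lintegral_pi_finSucc {n : ℕ} (ν : Fin (n + 1) → Measure α) [∀ i, SigmaFinite (ν i)]
    {f : (Fin (n + 1) → α) → ℝ≥0∞} (hf : Measurable f) :
    ∫⁻ x, f x ∂Measure.pi ν =
      ∫⁻ z, ∫⁻ y, f (Fin.cons y z) ∂ν 0 ∂Measure.pi fun i : Fin n => ν i.succ := by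
  have h := (measurePreserving_piFinSuccAbove ν 0).symm
  rw [← h.lintegral_comp hf]
  refine (lintegral_prod_symm' _ (hf.comp h.measurable)).trans ?_
  refine lintegral_congr fun z => lintegral_congr fun y => ?_
  simp [MeasurableEquiv.piFinSuccAbove, Fin.insertNthEquiv]

lemma lintegral_pi_prod {n : ℕ} (ν : Fin n → Measure α) [∀ i, IsProbabilityMeasure (ν i)]
    {f : Fin n → α → ℝ≥0∞} (hf : ∀ i, Measurable (f i)) :
    ∫⁻ x, ∏ i, f i (x i) ∂Measure.pi ν = ∏ i, ∫⁻ y, f i y ∂ν i := by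
  induction n with
  | zero => simp
  | succ n ih =>
    have hm : Measurable fun x : Fin (n + 1) → α => ∏ i, f i (x i) := by fun_prop
    have hm' : Measurable fun x : Fin n → α => ∏ i, f i.succ (x i) := by fun_prop
    rw [lintegral_pi_finSucc ν hm, Fin.prod_univ_succ]
    simp_rw [Fin.prod_univ_succ, Fin.cons_zero, Fin.cons_succ]
    simp_rw [lintegral_mul_const _ (hf 0)]
    rw [lintegral_const_mul _ hm', ih (fun i => ν i.succ) fun i => hf i.succ]

end PiIntegral

/-! ### Hanson–Wright lower tail, by induction on the coordinates. -/

/-- The constant in the lower tail Hanson–Wright inequality. -/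
def hwConst (L : ℝ) : ℝ := 4 * (3 + 2 * L ^ 2 + 8 * L ^ 4)

lemma hwConst_pos (L : ℝ) : 0 < hwConst L := by unfold hwConst; positivity

/-- In a symmetric form `0 ≤ M ≤ κ` the rows satisfy `|M e|² ≤ κ ⟨M e, e⟩`. -/
lemma sum_sq_row_le {ι : Type*} [Fintype ι] [DecidableEq ι] {M : ι → ι → ℝ} {κ : ℝ}
    (hsymm : ∀ i j, M i j = M j i) (hpos : ∀ x : ι → ℝ, 0 ≤ ∑ i, ∑ j, M i j * x i * x j)
    (hle : ∀ x : ι → ℝ, ∑ i, ∑ j, M i j * x i * x j ≤ κ * ∑ i, x i ^ 2) (i₀ : ι) :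
    ∑ j, M i₀ j ^ 2 ≤ κ * M i₀ i₀ := by
  set S := ∑ j, M i₀ j ^ 2 with hS
  have hS0 : 0 ≤ S := Finset.sum_nonneg fun j _ => sq_nonneg _
  set q := ∑ i, ∑ j, M i j * M i₀ i * M i₀ j with hq
  have hqκ : q ≤ κ * S := hle (M i₀)
  have hq0 : 0 ≤ q := hpos (M i₀)
  -- Test positivity on `t e + M e` with `e` the `i₀`-th basis vector; the discriminant in `t` is
  -- then nonpositive.
  have key : ∀ t : ℝ, 0 ≤ M i₀ i₀ * t ^ 2 + 2 * t * S + q := by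
    intro t
    have h := hpos fun i => t * (if i = i₀ then 1 else 0) + M i₀ i
    have e : ∑ i, ∑ j, M i j * (t * (if i = i₀ then 1 else 0) + M i₀ i) *
        (t * (if j = i₀ then 1 else 0) + M i₀ j) = M i₀ i₀ * t ^ 2 + 2 * t * S + q := by
      have e1 : ∀ i j, M i j * (t * (if i = i₀ then 1 else 0) + M i₀ i) *
          (t * (if j = i₀ then 1 else 0) + M i₀ j) =
          (if i = i₀ then (if j = i₀ then M i j * t ^ 2 else 0) else 0)
          + (if i = i₀ then t * (M i j * M i₀ j) else 0)
          + (if j = i₀ then t * (M i j * M i₀ i) else 0) + M i j * M i₀ i * M i₀ j := by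
        intro i j; split_ifs <;> ring
      simp_rw [e1, Finset.sum_add_distrib]
      have e2 : ∑ i, ∑ j, (if i = i₀ then (if j = i₀ then M i j * t ^ 2 else 0) else 0)
          = M i₀ i₀ * t ^ 2 := by
        rw [Finset.sum_eq_single i₀ (fun b _ hb => by simp [hb]) (by simp)]
        simp
      have e3 : ∑ i, ∑ j, (if i = i₀ then t * (M i j * M i₀ j) else 0) = t * S := by
        rw [Finset.sum_eq_single i₀ (fun b _ hb => by simp [hb]) (by simp)]
        simp [hS, Finset.mul_sum, sq]
      have e4 : ∑ i, ∑ j, (if j = i₀ then t * (M i j * M i₀ i) else 0) = t * S := by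
        simp only [Finset.sum_ite_eq', Finset.mem_univ, if_true, hS, Finset.mul_sum]
        exact Finset.sum_congr rfl fun i _ => by rw [hsymm i i₀]; ring
      rw [e2, e3, e4]; ring
    linarith
  have hdisc : S ^ 2 ≤ M i₀ i₀ * q := by
    have := discrim_le_zero (a := M i₀ i₀) (b := 2 * S) (c := q) fun t => by
      linarith [key t]
    unfold discrim at this; nlinarith
  have hM0 : 0 ≤ M i₀ i₀ := by
    have h := hpos fun i => if i = i₀ then 1 else 0
    simpa using h
  rcases hS0.eq_or_lt with h0 | h0
  · rw [← h0]
    have hκ : M i₀ i₀ ≤ κ := by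
      have h := hle fun i => if i = i₀ then 1 else 0
      simpa using h
    exact mul_nonneg (hM0.trans hκ) hM0
  · have : S * S ≤ κ * M i₀ i₀ * S := by nlinarith
    exact le_of_mul_le_mul_right this h0

/-- Lower tail Hanson–Wright inequality for a positive semidefinite form, in its exponential
moment form. -/
lemma lintegral_exp_neg_quadForm_le {L κ lam : ℝ} (hL : 0 < L) (hκ : 0 ≤ κ) (hlam : 0 ≤ lam)
    (hlk : hwConst L * lam * κ ≤ 1) {n : ℕ} {ν : Fin n → Measure ℝ}
    (hν : ∀ i, IsUnitSubgaussian L (ν i)) {M : Fin n → Fin n → ℝ}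
    (hsymm : ∀ i j, M i j = M j i) (hpos : ∀ x : Fin n → ℝ, 0 ≤ ∑ i, ∑ j, M i j * x i * x j)
    (hle : ∀ x : Fin n → ℝ, ∑ i, ∑ j, M i j * x i * x j ≤ κ * ∑ i, x i ^ 2) :
    ∫⁻ x, ENNReal.ofReal (Real.exp (-lam * ∑ i, ∑ j, M i j * x i * x j)) ∂Measure.pi ν ≤
      ENNReal.ofReal (Real.exp (-lam * (1 - hwConst L * lam * κ) * ∑ i, M i i)) := by
  induction n with
  | zero => simp
  | succ n ih =>
    have : ∀ i, IsProbabilityMeasure (ν i) := fun i => (hν i).prob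
    set D := hwConst L with hD
    have hD0 : 0 < D := hwConst_pos L
    have hrow := sum_sq_row_le hsymm hpos hle 0
    rw [Fin.sum_univ_succ] at hrow
    have hform : ∀ (y : ℝ) (z : Fin n → ℝ),
        ∑ i, ∑ j, M i j * (Fin.cons y z : Fin (n + 1) → ℝ) i * (Fin.cons y z : Fin (n + 1) → ℝ) j
        = M 0 0 * y ^ 2 + 2 * y * (∑ j, M 0 j.succ * z j)
          + ∑ i, ∑ j, M i.succ j.succ * z i * z j := by
      intro y z
      simp only [Fin.sum_univ_succ, Fin.cons_zero, Fin.cons_succ, Finset.sum_add_distrib]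
      have e1 : ∑ i : Fin n, M i.succ 0 * z i * y = y * ∑ j, M 0 j.succ * z j := by
        rw [Finset.mul_sum]; exact Finset.sum_congr rfl fun i _ => by rw [hsymm]; ring
      have e2 : ∑ i : Fin n, M 0 i.succ * y * z i = y * ∑ j, M 0 j.succ * z j := by
        rw [Finset.mul_sum]; exact Finset.sum_congr rfl fun i _ => by ring
      rw [e1, e2]; ring
    have hM0 : 0 ≤ M 0 0 := by
      have h := hpos (Fin.cons 1 0); rw [hform] at h; simpa using h
    have hMκ : M 0 0 ≤ κ := by
      have h := hle (Fin.cons 1 0); rw [hform, Fin.sum_univ_succ] at h; simpa using h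
    -- Integrating out the first coordinate creates a term `D λ² r²`, with `r` the pairing of the
    -- first row with `z`. Subtracting a rank-one form from the remaining block absorbs it.
    set M' : Fin n → Fin n → ℝ := fun i j =>
      M i.succ j.succ - D * lam * (M 0 i.succ * M 0 j.succ) with hM'
    have hform' : ∀ z : Fin n → ℝ, ∑ i, ∑ j, M' i j * z i * z j =
        ∑ i, ∑ j, M i.succ j.succ * z i * z j - D * lam * (∑ j, M 0 j.succ * z j) ^ 2 := by
      intro z
      rw [sq, Finset.sum_mul_sum, Finset.mul_sum, ← Finset.sum_sub_distrib]
      refine Finset.sum_congr rfl fun i _ => ?_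
      rw [Finset.mul_sum, ← Finset.sum_sub_distrib]
      exact Finset.sum_congr rfl fun j _ => by simp only [hM']; ring
    have hDl : 0 ≤ D * lam := by positivity
    have hDM : D * lam * M 0 0 ≤ 1 := (mul_le_mul_of_nonneg_left hMκ hDl).trans hlk
    have IH := ih (ν := fun i => ν i.succ) (fun i => hν i.succ) (M := M')
      (fun i j => by simp only [hM']; rw [hsymm]; ring)
      (fun z => by
        rw [hform']
        -- The first coordinate `-Dλr` makes positivity of `M` yield that of `M'`, because `D λ M₀₀
        -- ≤ 1`.
        have h := hpos (Fin.cons (-(D * lam * ∑ j, M 0 j.succ * z j)) z)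
        rw [hform] at h
        set r := ∑ j, M 0 j.succ * z j
        have : 0 ≤ D * lam * r ^ 2 * (1 - D * lam * M 0 0) :=
          mul_nonneg (by positivity) (by linarith)
        nlinarith)
      (fun z => by
        rw [hform']
        have h := hle (Fin.cons 0 z)
        rw [hform, Fin.sum_univ_succ] at h
        simp only [Fin.cons_zero, Fin.cons_succ] at h
        have : 0 ≤ D * lam * (∑ j, M 0 j.succ * z j) ^ 2 := by positivity
        nlinarith)
    have hmeas : Measurable fun x : Fin (n + 1) → ℝ =>
        ENNReal.ofReal (Real.exp (-lam * ∑ i, ∑ j, M i j * x i * x j)) := by fun_prop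
    rw [lintegral_pi_finSucc ν hmeas]
    have hstep : ∀ z : Fin n → ℝ,
        ∫⁻ y, ENNReal.ofReal (Real.exp (-lam * ∑ i, ∑ j, M i j *
          (Fin.cons y z : Fin (n + 1) → ℝ) i * (Fin.cons y z : Fin (n + 1) → ℝ) j)) ∂ν 0 ≤
        ENNReal.ofReal (Real.exp (-(lam * M 0 0) + D * lam ^ 2 * M 0 0 ^ 2)) *
          ENNReal.ofReal (Real.exp (-lam * ∑ i, ∑ j, M' i j * z i * z j)) := by
      intro z
      set r := ∑ j, M 0 j.succ * z j with hr
      set q := ∑ i, ∑ j, M i.succ j.succ * z i * z j with hq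
      have h1 := (hν 0).lintegral_exp_linear_sub_sq_le hL (a := lam * M 0 0) (by positivity)
        (-2 * lam * r)
      have e : ∀ y : ℝ, ENNReal.ofReal (Real.exp (-lam * ∑ i, ∑ j, M i j *
          (Fin.cons y z : Fin (n + 1) → ℝ) i * (Fin.cons y z : Fin (n + 1) → ℝ) j)) =
          ENNReal.ofReal (Real.exp (-lam * q)) *
          ENNReal.ofReal (Real.exp ((-2 * lam * r) * y - lam * M 0 0 * y ^ 2)) := by
        intro y
        rw [hform, ← ENNReal.ofReal_mul (Real.exp_pos _).le, ← Real.exp_add]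
        congr 2; ring
      simp_rw [e]
      rw [lintegral_const_mul _ (by fun_prop)]
      refine (mul_le_mul_right h1 _).trans ?_
      rw [← ENNReal.ofReal_mul (Real.exp_pos _).le, ← ENNReal.ofReal_mul (Real.exp_pos _).le,
        ← Real.exp_add, ← Real.exp_add, hform']
      refine ENNReal.ofReal_le_ofReal (Real.exp_le_exp.2 ?_)
      have : D = 4 * (3 + 2 * L ^ 2 + 8 * L ^ 4) := rfl
      have h0 : 0 ≤ (3 + 2 * L ^ 2 + 8 * L ^ 4) * (lam ^ 2 * M 0 0 ^ 2) := by positivity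
      rw [this, ← sub_nonneg]
      refine le_trans (mul_nonneg (by norm_num : (0 : ℝ) ≤ 3) h0) (le_of_eq ?_)
      ring
    refine (lintegral_mono hstep).trans ?_
    rw [lintegral_const_mul _ (by fun_prop)]
    refine (mul_le_mul_right IH _).trans ?_
    rw [← ENNReal.ofReal_mul (Real.exp_pos _).le, ← Real.exp_add]
    refine ENNReal.ofReal_le_ofReal (Real.exp_le_exp.2 ?_)
    have htr : ∑ i, M' i i = ∑ i : Fin n, M i.succ i.succ
        - D * lam * ∑ i : Fin n, M 0 i.succ ^ 2 := by
      simp only [hM', Finset.sum_sub_distrib, Finset.mul_sum, sq]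
    rw [htr, Fin.sum_univ_succ]
    set S := ∑ i : Fin n, M 0 i.succ ^ 2
    have hS : 0 ≤ S := Finset.sum_nonneg fun i _ => sq_nonneg _
    -- The trace lost to the rank-one correction and the term `M₀₀²` are paid for together by the
    -- row bound `M₀₀² + S ≤ κ M₀₀`.
    have hx : 0 ≤ D * lam ^ 2 * (κ * M 0 0 - M 0 0 ^ 2 - S) :=
      mul_nonneg (by positivity) (by linarith)
    have hy : 0 ≤ D * lam ^ 2 * S * (D * lam * κ) := by positivity
    nlinarith

/-! ### Simple tensors: induction on the degree. -/

/-- The coefficients of the simple tensor with factors `x k`. -/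
def tensorCoeff {d n : ℕ} (x : Fin d → Fin n → ℝ) (i : Fin d → Fin n) : ℝ := ∏ k, x k (i k)

/-- The sum of squares of the linear functionals with coefficient vectors `A r`. -/
def gramForm {R ι : Type*} [Fintype R] [Fintype ι] (A : R → ι → ℝ) (v : ι → ℝ) : ℝ :=
  ∑ r, (∑ i, A r i * v i) ^ 2

lemma sum_finCons {d n : ℕ} {M : Type*} [AddCommMonoid M] (f : (Fin (d + 1) → Fin n) → M) :
    ∑ i, f i = ∑ a, ∑ i : Fin d → Fin n, f (Fin.cons a i) := by
  rw [← Fintype.sum_prod_type' (f := fun a i => f (Fin.cons a i))]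
  exact (Fintype.sum_equiv (Fin.consEquiv fun _ => Fin n) _ _ fun _ => rfl).symm

lemma tensorCoeff_cons {d n : ℕ} (y : Fin n → ℝ) (z : Fin d → Fin n → ℝ) (a : Fin n)
    (i : Fin d → Fin n) :
    tensorCoeff (Fin.cons y z : Fin (d + 1) → Fin n → ℝ) (Fin.cons a i) =
      y a * tensorCoeff z i := by
  simp [tensorCoeff, Fin.prod_univ_succ]

lemma sum_sq_tensorCoeff {d n : ℕ} (x : Fin d → Fin n → ℝ) :
    ∑ i, tensorCoeff x i ^ 2 = ∏ k, ∑ j, x k j ^ 2 := by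
  rw [Finset.prod_univ_sum, Fintype.piFinset_univ]
  simp [tensorCoeff, Finset.prod_pow]

/-- The tuples all of whose proper final segments have a product of squared norms that is at most
`B` times its expectation. -/
def controlledTails (B : ℝ) (n : ℕ) : ∀ d : ℕ, Set (Fin d → Fin n → ℝ)
  | 0 => Set.univ
  | d + 1 => {x | ∏ k : Fin d, ∑ j, x k.succ j ^ 2 ≤ B * (n : ℝ) ^ d ∧
      (fun k : Fin d => x k.succ) ∈ controlledTails B n d}

lemma measurableSet_controlledTails (B : ℝ) (n d : ℕ) :
    MeasurableSet (controlledTails B n d) := by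
  induction d with
  | zero => exact MeasurableSet.univ
  | succ d ih =>
    have h : Measurable fun x : Fin (d + 1) → Fin n → ℝ => ∏ k : Fin d, ∑ j, x k.succ j ^ 2 := by
      fun_prop
    refine MeasurableSet.inter (measurableSet_le h measurable_const) ?_
    exact (measurable_pi_lambda _ fun k => measurable_pi_apply k.succ) ih

lemma measurable_tensorCoeff {d n : ℕ} (i : Fin d → Fin n) :
    Measurable fun x : Fin d → Fin n → ℝ => tensorCoeff x i := by
  unfold tensorCoeff; fun_prop

lemma measurable_gramForm_tensorCoeff {R : Type*} [Fintype R] {d n : ℕ}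
    (A : R → (Fin d → Fin n) → ℝ) :
    Measurable fun x : Fin d → Fin n → ℝ => gramForm A (tensorCoeff x) := by
  unfold gramForm
  have := fun i : Fin d → Fin n => measurable_tensorCoeff i
  fun_prop

/-- The exponential moment bound for a form evaluated at a simple random tensor, restricted to the
event that the norms of the tails are controlled. -/
lemma lintegral_controlledTails_exp_neg_gramForm_le {L B κ : ℝ} (hL : 0 < L) (hκ : 0 ≤ κ) {n : ℕ}
    (hn : 0 < n) {R : Type} [Fintype R] {d : ℕ} {A : R → (Fin d → Fin n) → ℝ} {ρ lam : ℝ}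
    (hρ : 0 ≤ ρ) (hB : B * ρ * (n : ℝ) ^ d ≤ κ * n)
    (hA : ∀ v, gramForm A v ≤ ρ * ∑ i, v i ^ 2) (hlam : 0 ≤ lam)
    (hlk : hwConst L * lam * κ ≤ 1) {ν : Fin d → Fin n → Measure ℝ}
    (hν : ∀ k j, IsUnitSubgaussian L (ν k j)) :
    ∫⁻ x, (controlledTails B n d).indicator
        (fun x => ENNReal.ofReal (Real.exp (-lam * gramForm A (tensorCoeff x)))) x
        ∂Measure.pi (fun k => Measure.pi (ν k)) ≤
      ENNReal.ofReal (Real.exp (-lam * (1 - hwConst L * lam * κ) ^ d * ∑ r, ∑ i, A r i ^ 2)) := by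
  induction d generalizing R ρ lam with
  | zero =>
    have h : ∀ x : Fin 0 → Fin n → ℝ, tensorCoeff x = 1 := fun x => by
      ext i; simp [tensorCoeff]
    simp [controlledTails, gramForm, h]
  | succ d ih =>
    have hp : ∀ k j, IsProbabilityMeasure (ν k j) := fun k j => (hν k j).prob
    have hn' : (0 : ℝ) < n := by exact_mod_cast hn
    set D := hwConst L with hD
    have hD0 : 0 < D := hwConst_pos L
    set lam' := lam * (1 - D * lam * κ) with hlam'
    have h1 : 0 ≤ D * lam * κ := by positivity
    have h2 : 0 ≤ 1 - D * lam * κ := by linarith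
    have hlam'0 : 0 ≤ lam' := by positivity
    have hlam'le : lam' ≤ lam := by rw [hlam']; nlinarith
    have hDle : D * lam' * κ ≤ D * lam * κ := by gcongr
    -- Moving the first tensor index into the index set of functionals preserves the Hilbert–Schmidt
    -- norm. The form bound grows from `ρ` to `ρ n`, which keeps `B ρ n^d` unchanged as the degree
    -- drops.
    set A' : R × Fin n → (Fin d → Fin n) → ℝ := fun p i => A p.1 (Fin.cons p.2 i) with hA'
    have htr : ∑ r, ∑ i, A r i ^ 2 = ∑ p, ∑ i, A' p i ^ 2 := by
      rw [Fintype.sum_prod_type]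
      exact Finset.sum_congr rfl fun r _ => sum_finCons _
    have hcontr : ∀ (r : R) (y : Fin n → ℝ) (w : (Fin d → Fin n) → ℝ),
        ∑ i, A r i * (y (i 0) * w (Fin.tail i)) = ∑ a, (∑ i, A' (r, a) i * w i) * y a := by
      intro r y w
      rw [sum_finCons]
      refine Finset.sum_congr rfl fun a _ => ?_
      rw [Finset.sum_mul]
      exact Finset.sum_congr rfl fun i _ => by simp [hA']; ring
    have hbd : ∀ (y : Fin n → ℝ) (w : (Fin d → Fin n) → ℝ),
        ∑ r, (∑ a, (∑ i, A' (r, a) i * w i) * y a) ^ 2 ≤ ρ * ((∑ a, y a ^ 2) * ∑ i, w i ^ 2) := by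
      intro y w
      have h := hA fun i => y (i 0) * w (Fin.tail i)
      have e : ∑ i : Fin (d + 1) → Fin n, (y (i 0) * w (Fin.tail i)) ^ 2 =
          (∑ a, y a ^ 2) * ∑ i, w i ^ 2 := by
        rw [sum_finCons, Finset.sum_mul_sum]
        simp [mul_pow]
      rw [e] at h
      simpa only [gramForm, hcontr] using h
    have hA'ρ : ∀ w, gramForm A' w ≤ (ρ * n) * ∑ i, w i ^ 2 := by
      intro w
      have e : gramForm A' w = ∑ b : Fin n, ∑ r,
          (∑ a, (∑ i, A' (r, a) i * w i) * (if a = b then 1 else 0)) ^ 2 := by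
        rw [gramForm, Fintype.sum_prod_type, Finset.sum_comm]
        simp
      rw [e]
      calc _ ≤ ∑ b : Fin n, ρ * ((∑ a, (if a = b then (1 : ℝ) else 0) ^ 2) * ∑ i, w i ^ 2) :=
            Finset.sum_le_sum fun b _ => hbd _ _
        _ = _ := by simp; ring
    have IH := ih (R := R × Fin n) (A := A') (ρ := ρ * n) (lam := lam') (by positivity)
      (by rw [pow_succ] at hB; linarith) hA'ρ hlam'0 (hDle.trans hlk)
      (ν := fun k => ν k.succ) (fun k => hν k.succ)
    have hmeas : Measurable ((controlledTails B n (d + 1)).indicator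
        (fun x => ENNReal.ofReal (Real.exp (-lam * gramForm A (tensorCoeff x))))) := by
      have := measurable_gramForm_tensorCoeff A
      exact Measurable.indicator (by fun_prop) (measurableSet_controlledTails B n (d + 1))
    rw [lintegral_pi_finSucc _ hmeas]
    have hstep : ∀ z : Fin d → Fin n → ℝ,
        ∫⁻ y, (controlledTails B n (d + 1)).indicator
          (fun x => ENNReal.ofReal (Real.exp (-lam * gramForm A (tensorCoeff x))))
          (Fin.cons y z) ∂Measure.pi (ν 0) ≤
        (controlledTails B n d).indicator
          (fun x => ENNReal.ofReal (Real.exp (-lam' * gramForm A' (tensorCoeff x)))) z := by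
      intro z
      by_cases hz : ∏ k : Fin d, ∑ j, z k j ^ 2 ≤ B * (n : ℝ) ^ d ∧ z ∈ controlledTails B n d
      · have hmem : ∀ y : Fin n → ℝ,
            (Fin.cons y z : Fin (d + 1) → Fin n → ℝ) ∈ controlledTails B n (d + 1) := fun y => by
          simpa [controlledTails] using hz
        simp_rw [Set.indicator_of_mem (hmem _), Set.indicator_of_mem hz.2]
        set u : R → Fin n → ℝ := fun r a => ∑ i, A' (r, a) i * tensorCoeff z i with hu
        have hq : ∀ y : Fin n → ℝ, ∑ a, ∑ b, (∑ r, u r a * u r b) * y a * y b =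
            ∑ r, (∑ a, u r a * y a) ^ 2 := by
          intro y
          simp_rw [sq, Finset.sum_mul_sum, Finset.sum_mul]
          rw [Finset.sum_comm' (t' := Finset.univ) (s' := fun _ => Finset.univ) (by simp)]
          conv_rhs => rw [Finset.sum_comm]
          rw [Finset.sum_comm]
          refine Finset.sum_congr rfl fun a _ => ?_
          rw [Finset.sum_comm]
          exact Finset.sum_congr rfl fun r _ => Finset.sum_congr rfl fun b _ => by ring
        have hform : ∀ y : Fin n → ℝ,
            gramForm A (tensorCoeff (Fin.cons y z : Fin (d + 1) → Fin n → ℝ)) =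
            ∑ a, ∑ b, (∑ r, u r a * u r b) * y a * y b := by
          intro y
          rw [hq, gramForm]
          refine Finset.sum_congr rfl fun r _ => ?_
          rw [← hcontr]
          congr 1
          refine Finset.sum_congr rfl fun i _ => ?_
          rw [← tensorCoeff_cons, Fin.cons_self_tail]
        have hκle : ∀ y : Fin n → ℝ, ∑ a, ∑ b, (∑ r, u r a * u r b) * y a * y b ≤
            κ * ∑ a, y a ^ 2 := by
          intro y
          rw [hq]
          refine (hbd y (tensorCoeff z)).trans ?_
          rw [sum_sq_tensorCoeff]
          have hB' : ρ * (B * (n : ℝ) ^ d) ≤ κ := by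
            refine le_of_mul_le_mul_right ?_ hn'
            rw [pow_succ] at hB; linarith
          have hy : 0 ≤ ∑ a, y a ^ 2 := Finset.sum_nonneg fun _ _ => sq_nonneg _
          calc _ = (ρ * ∏ k : Fin d, ∑ j, z k j ^ 2) * ∑ a, y a ^ 2 := by ring
            _ ≤ κ * ∑ a, y a ^ 2 := mul_le_mul_of_nonneg_right
                ((mul_le_mul_of_nonneg_left hz.1 hρ).trans hB') hy
        have hHW := lintegral_exp_neg_quadForm_le hL hκ hlam hlk (hν 0)
          (M := fun a b => ∑ r, u r a * u r b)
          (fun a b => Finset.sum_congr rfl fun r _ => mul_comm _ _)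
          (fun y => by rw [hq]; exact Finset.sum_nonneg fun _ _ => sq_nonneg _) hκle
        simp_rw [hform]
        refine hHW.trans (le_of_eq ?_)
        have e : ∑ a, ∑ r, u r a * u r a = gramForm A' (tensorCoeff z) := by
          rw [gramForm, Fintype.sum_prod_type, Finset.sum_comm]
          simp [hu, sq]
        rw [e, hlam']
        congr 2; ring
      · have hmem : ∀ y : Fin n → ℝ,
            (Fin.cons y z : Fin (d + 1) → Fin n → ℝ) ∉ controlledTails B n (d + 1) := fun y => by
          simpa [controlledTails] using hz
        simp_rw [Set.indicator_of_notMem (hmem _)]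
        simp
    refine (lintegral_mono hstep).trans (IH.trans ?_)
    refine ENNReal.ofReal_le_ofReal (Real.exp_le_exp.2 ?_)
    rw [htr]
    have hT : 0 ≤ ∑ p, ∑ i, A' p i ^ 2 :=
      Finset.sum_nonneg fun _ _ => Finset.sum_nonneg fun _ _ => sq_nonneg _
    -- As `lam' ≤ lam`, later losses are smaller, so the first loss factor bounds them all.
    have h3 : (1 - D * lam * κ) ^ d ≤ (1 - D * lam' * κ) ^ d := by gcongr
    have h4 := mul_le_mul_of_nonneg_left h3 hlam'0
    have h5 := mul_le_mul_of_nonneg_right h4 hT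
    have h6 : lam * (1 - D * lam * κ) ^ (d + 1) = lam' * (1 - D * lam * κ) ^ d := by
      rw [hlam']; ring
    have h7 : -lam * (1 - D * lam * κ) ^ (d + 1) = -(lam' * (1 - D * lam * κ) ^ d) := by
      rw [← h6]; ring
    rw [h7]
    linarith

/-! ### Concentration of products of squared norms. -/

/-- Each centred square contributes only `16 L⁴ (θ/n)²` to the exponent; over `d n` coordinates this
totals at most `θ/2`. The parameter `m ≥ d` keeps the hypotheses fixed while `d` decreases in the
induction that uses this bound. -/
lemma lintegral_prod_exp_sq_le {L θ : ℝ} (hL : 0 < L) {n : ℕ} (hn : 0 < n) {m : ℕ}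
    (hθ : 0 ≤ θ) (hθL : θ * (2 * L ^ 2) ≤ n) (hθm : 32 * L ^ 4 * m * θ ≤ n) {d : ℕ} (hd : d ≤ m)
    {ν : Fin d → Fin n → Measure ℝ} (hν : ∀ k j, IsUnitSubgaussian L (ν k j)) :
    ∫⁻ z, ∏ k, ∏ j, ENNReal.ofReal (Real.exp (θ / n * z k j ^ 2 - θ / n))
      ∂Measure.pi (fun k => Measure.pi (ν k)) ≤ ENNReal.ofReal (Real.exp (θ / 2)) := by
  have hp : ∀ k j, IsProbabilityMeasure (ν k j) := fun k j => (hν k j).prob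
  have hn' : (0 : ℝ) < n := by exact_mod_cast hn
  set g : ℝ → ℝ≥0∞ := fun x => ENNReal.ofReal (Real.exp (θ / n * x ^ 2 - θ / n)) with hg
  have hgm : Measurable g := by fun_prop
  have e1 : ∀ (k : Fin d) (j : Fin n), ∫⁻ x, g x ∂ν k j ≤
      ENNReal.ofReal (Real.exp (16 * L ^ 4 * (θ / n) ^ 2)) := by
    intro k j
    have h := (hν k j).lintegral_exp_mul_sq_le hL (θ := θ / n) (by positivity)
      (by rw [div_mul_eq_mul_div, div_le_one hn']; exact hθL)
    simp_rw [hg, sub_eq_add_neg, Real.exp_add, ENNReal.ofReal_mul (Real.exp_pos _).le]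
    rw [lintegral_mul_const _ (by fun_prop)]
    refine (mul_le_mul_left h _).trans ?_
    rw [← ENNReal.ofReal_mul (Real.exp_pos _).le, ← Real.exp_add]
    exact ENNReal.ofReal_le_ofReal (Real.exp_le_exp.2 (by linarith))
  have e2 : ∀ k : Fin d, ∫⁻ y : Fin n → ℝ, ∏ j, g (y j) ∂Measure.pi (ν k) ≤
      ENNReal.ofReal (Real.exp (16 * L ^ 4 * (θ / n) ^ 2)) ^ n := by
    intro k
    refine (lintegral_pi_prod (ν k) (f := fun _ => g) fun _ => hgm).le.trans ?_
    refine (Finset.prod_le_prod' fun j _ => e1 k j).trans ?_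
    simp
  have hfm : Measurable fun y : Fin n → ℝ => ∏ j, g (y j) := by fun_prop
  refine (lintegral_pi_prod (fun k => Measure.pi (ν k)) (f := fun _ y => ∏ j, g (y j))
    fun _ => hfm).le.trans ?_
  refine (Finset.prod_le_prod' fun k _ => e2 k).trans ?_
  rw [Finset.prod_const, Finset.card_univ, Fintype.card_fin,
    ← ENNReal.ofReal_pow (Real.exp_pos _).le, ← ENNReal.ofReal_pow (by positivity),
    ← Real.exp_nat_mul, ← Real.exp_nat_mul]
  refine ENNReal.ofReal_le_ofReal (Real.exp_le_exp.2 ?_)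
  have hdm : (d : ℝ) ≤ m := by exact_mod_cast hd
  have e3 : 32 * L ^ 4 * d * θ ≤ n := le_trans (by gcongr) hθm
  have e4 : (d : ℝ) * (n * (16 * L ^ 4 * (θ / n) ^ 2)) =
      (32 * L ^ 4 * d * θ) * θ / (2 * n) := by field_simp; ring
  rw [e4, div_le_div_iff₀ (by positivity) (by norm_num)]
  nlinarith

/-- The tails of a simple random tensor are controlled with high probability. -/
lemma measure_compl_controlledTails_le {L θ : ℝ} (hL : 0 < L) {n : ℕ} (hn : 0 < n) {m : ℕ}
    (hθ : 0 ≤ θ) (hθL : θ * (2 * L ^ 2) ≤ n) (hθm : 32 * L ^ 4 * m * θ ≤ n) {d : ℕ} (hd : d ≤ m)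
    {ν : Fin d → Fin n → Measure ℝ} (hν : ∀ k j, IsUnitSubgaussian L (ν k j)) :
    Measure.pi (fun k => Measure.pi (ν k)) (controlledTails (Real.exp 1) n d)ᶜ ≤
      ENNReal.ofReal (d * Real.exp (-(θ / 2))) := by
  have hp : ∀ k j, IsProbabilityMeasure (ν k j) := fun k j => (hν k j).prob
  have hn' : (0 : ℝ) < n := by exact_mod_cast hn
  induction d with
  | zero => simp [controlledTails]
  | succ d ih =>
    have hν' : ∀ (k : Fin d) j, IsUnitSubgaussian L (ν k.succ j) := fun k j => hν k.succ j
    have IH := ih (by omega) hν' fun k => hp k.succ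
    set μ' := Measure.pi fun k : Fin d => Measure.pi (ν k.succ) with hμ'
    set F : Set (Fin d → Fin n → ℝ) :=
      {z | ∏ k : Fin d, ∑ j, z k j ^ 2 ≤ Real.exp 1 * (n : ℝ) ^ d} with hF
    have hFm : MeasurableSet F := measurableSet_le (by fun_prop) measurable_const
    have hGm := measurableSet_controlledTails (Real.exp 1) n d
    have hred : Measure.pi (fun k => Measure.pi (ν k)) (controlledTails (Real.exp 1) n (d + 1))ᶜ
        = μ' (F ∩ controlledTails (Real.exp 1) n d)ᶜ := by
      rw [← lintegral_indicator_one (measurableSet_controlledTails _ _ _).compl,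
        lintegral_pi_finSucc _
          (measurable_one.indicator (measurableSet_controlledTails _ _ _).compl),
        ← lintegral_indicator_one (hFm.inter hGm).compl]
      refine lintegral_congr fun z => ?_
      have : ∀ y : Fin n → ℝ, (controlledTails (Real.exp 1) n (d + 1))ᶜ.indicator
          (1 : (Fin (d + 1) → Fin n → ℝ) → ℝ≥0∞) (Fin.cons y z) =
          (F ∩ controlledTails (Real.exp 1) n d)ᶜ.indicator (1 : (Fin d → Fin n → ℝ) → ℝ≥0∞) z := by
        intro y
        exact Set.indicator_eq_indicator Iff.rfl rfl
      simp_rw [this]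
      simp
    have hFc : μ' Fᶜ ≤ ENNReal.ofReal (Real.exp (-(θ / 2))) := by
      have hsub : Fᶜ ⊆ {z | ENNReal.ofReal (Real.exp θ) ≤
          ∏ k, ∏ j, ENNReal.ofReal (Real.exp (θ / n * z k j ^ 2 - θ / n))} := by
        intro z hz
        have hz' : Real.exp 1 * (n : ℝ) ^ d < ∏ k : Fin d, ∑ j, z k j ^ 2 := not_le.1 hz
        -- Applying `u ≤ exp (u - 1)` to each factor turns a large product into a large sum, to
        -- which Chernoff applies.
        have e1 : ∏ k : Fin d, ∑ j, z k j ^ 2 ≤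
            (n : ℝ) ^ d * Real.exp (∑ k : Fin d, ((∑ j, z k j ^ 2) / n - 1)) := by
          rw [Real.exp_sum]
          have : (n : ℝ) ^ d = ∏ _k : Fin d, (n : ℝ) := by simp
          rw [this, ← Finset.prod_mul_distrib]
          refine Finset.prod_le_prod (fun k _ => Finset.sum_nonneg fun _ _ => sq_nonneg _)
            fun k _ => ?_
          have h := Real.add_one_le_exp ((∑ j, z k j ^ 2) / n - 1)
          calc ∑ j, z k j ^ 2 = n * ((∑ j, z k j ^ 2) / n) := by field_simp
            _ ≤ _ := by gcongr; linarith
        have e2 : 1 < ∑ k : Fin d, ((∑ j, z k j ^ 2) / n - 1) := by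
          rw [← Real.exp_lt_exp]
          refine lt_of_mul_lt_mul_left ?_ (by positivity : (0 : ℝ) ≤ (n : ℝ) ^ d)
          linarith
        simp only [Set.mem_ofPred_eq]
        simp_rw [← ENNReal.ofReal_prod_of_nonneg fun i (_ : i ∈ Finset.univ) =>
          (Real.exp_pos (θ / n * z _ i ^ 2 - θ / n)).le, ← Real.exp_sum]
        rw [← ENNReal.ofReal_prod_of_nonneg fun i _ => (Real.exp_pos _).le, ← Real.exp_sum]
        refine ENNReal.ofReal_le_ofReal (Real.exp_le_exp.2 ?_)
        have e3 : ∑ k : Fin d, ∑ j, (θ / n * z k j ^ 2 - θ / n) =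
            θ * ∑ k : Fin d, ((∑ j, z k j ^ 2) / n - 1) := by
          rw [Finset.mul_sum]
          refine Finset.sum_congr rfl fun k _ => ?_
          rw [Finset.sum_sub_distrib, ← Finset.mul_sum]
          simp
          field_simp
        rw [e3]
        nlinarith
      have hint := lintegral_prod_exp_sq_le hL hn hθ hθL hθm (by omega : d ≤ m) hν'
      refine (measure_mono hsub).trans ?_
      refine (meas_ge_le_lintegral_div (Measurable.aemeasurable (by fun_prop)) (by simp [Real.exp_pos]) (by simp)).trans ?_
      refine (ENNReal.div_le_div_right hint _).trans ?_
      rw [← ENNReal.ofReal_div_of_pos (Real.exp_pos _), ← Real.exp_sub]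
      exact ENNReal.ofReal_le_ofReal (Real.exp_le_exp.2 (by linarith))
    rw [hred, Set.compl_inter]
    refine (measure_union_le _ _).trans ((add_le_add hFc IH).trans ?_)
    rw [← ENNReal.ofReal_add (Real.exp_pos _).le (by positivity)]
    refine ENNReal.ofReal_le_ofReal (le_of_eq ?_)
    push_cast; ring

/-! ### Lower tail for a projected simple tensor. -/

/-- Lower tail of the norm of the image of a simple random tensor under a contraction whose
Hilbert–Schmidt norm is at least `√(ε n ^ d)`. -/
lemma exists_measure_gramForm_lt_le {L : ℝ} (hL : 0 < L) : ∃ c : ℝ, 0 < c ∧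
    ∀ (n d : ℕ) (_ : 0 < n) (_ : 0 < d) (ε : ℝ) (_ : 0 ≤ ε) (_ : ε ≤ 1) (R : Type) [Fintype R]
      (A : R → (Fin d → Fin n) → ℝ) (_ : ∀ v, gramForm A v ≤ ∑ i, v i ^ 2)
      (_ : ε * (n : ℝ) ^ d ≤ ∑ r, ∑ i, A r i ^ 2) (ν : Fin d → Fin n → Measure ℝ)
      (_ : ∀ k j, IsUnitSubgaussian L (ν k j)),
      Measure.pi (fun k => Measure.pi (ν k))
        {x | gramForm A (tensorCoeff x) < ε * (n : ℝ) ^ d / 4} ≤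
        ENNReal.ofReal ((1 + d) * Real.exp (-(c * ε * n / d))) := by
  set D := hwConst L with hD
  have hD0 : 0 < D := hwConst_pos L
  -- Chosen so that `θ = β n / d` meets both smallness conditions of the Chernoff bound.
  set β := 1 / (2 * L ^ 2 + 32 * L ^ 4) with hβ
  have hβ0 : 0 < β := by positivity
  set c := min (1 / (8 * D * Real.exp 1)) (β / 2) with hc
  have hc1 : c ≤ 1 / (8 * D * Real.exp 1) := min_le_left _ _
  have hc2 : c ≤ β / 2 := min_le_right _ _
  refine ⟨c, by positivity, fun n d hn hd ε hε hε1 R _ A hA hT ν hν => ?_⟩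
  have hp : ∀ k j, IsProbabilityMeasure (ν k j) := fun k j => (hν k j).prob
  have hn' : (0 : ℝ) < n := by exact_mod_cast hn
  have hd' : (1 : ℝ) ≤ d := by exact_mod_cast hd
  have hd0 : (0 : ℝ) < d := by linarith
  set μ := Measure.pi fun k => Measure.pi (ν k) with hμ
  set G := controlledTails (Real.exp 1) n d with hG
  have hGc : μ Gᶜ ≤ ENNReal.ofReal (d * Real.exp (-(c * ε * n / d))) := by
    have hLβ : β * (2 * L ^ 2) ≤ 1 := by
      rw [hβ, one_div_mul_eq_div, div_le_one (by positivity)]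
      have : 0 ≤ 32 * L ^ 4 := by positivity
      linarith
    have hLβ' : β * (32 * L ^ 4) ≤ 1 := by
      rw [hβ, one_div_mul_eq_div, div_le_one (by positivity)]
      have : 0 ≤ 2 * L ^ 2 := by positivity
      linarith
    have h := measure_compl_controlledTails_le hL hn (m := d) (θ := β * n / d) (by positivity)
      (by
        rw [div_mul_eq_mul_div, div_le_iff₀ hd0]
        nlinarith)
      (by
        have : 32 * L ^ 4 * d * (β * n / d) = β * (32 * L ^ 4) * n := by field_simp
        rw [this]; nlinarith) le_rfl hν
    refine h.trans (ENNReal.ofReal_le_ofReal ?_)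
    refine mul_le_mul_of_nonneg_left (Real.exp_le_exp.2 (neg_le_neg ?_)) hd0.le
    have e : β * n / d / 2 = β / 2 * n / d := by ring
    have hcε : c * ε ≤ β / 2 := by nlinarith
    rw [e]
    gcongr
  set κ := Real.exp 1 * (n : ℝ) ^ d / n with hκ
  have hκ0 : 0 < κ := by positivity
  -- Makes each loss `1/(4d)`, so by Bernoulli a fraction `3/4` of the mean survives. The threshold
  -- uses a quarter of the mean, leaving `λ ε n^d / 2` in the exponent.
  set lam := 1 / (4 * d * D * κ) with hlam
  have hlam0 : 0 < lam := by positivity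
  have hDlk : D * lam * κ = 1 / (4 * d) := by rw [hlam]; field_simp
  have hle : 1 / (4 * (d : ℝ)) ≤ 1 := by
    rw [div_le_one (by positivity)]; linarith
  have hexp := lintegral_controlledTails_exp_neg_gramForm_le hL hκ0.le hn (ρ := 1) (lam := lam)
    (B := Real.exp 1) (A := A) zero_le_one (le_of_eq (by rw [hκ]; field_simp)) (by simpa using hA)
    hlam0.le (by rw [← hD, hDlk]; exact hle) hν
  rw [← hD, hDlk] at hexp
  have hbern : (3 / 4 : ℝ) ≤ (1 - 1 / (4 * (d : ℝ))) ^ d := by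
    have h := one_add_mul_le_pow (a := -(1 / (4 * (d : ℝ)))) (by linarith) d
    have e : 1 + (d : ℝ) * -(1 / (4 * (d : ℝ))) = 3 / 4 := by field_simp; norm_num
    rw [e] at h
    exact h
  set s := ε * (n : ℝ) ^ d / 4 with hs
  have hs0 : 0 ≤ s := by positivity
  set f : (Fin d → Fin n → ℝ) → ℝ≥0∞ :=
    G.indicator fun x => ENNReal.ofReal (Real.exp (-lam * gramForm A (tensorCoeff x))) with hf
  have hfm : Measurable f := by
    have := measurable_gramForm_tensorCoeff A
    exact Measurable.indicator (by fun_prop) (measurableSet_controlledTails _ n d)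
  have hmain : μ {x | ENNReal.ofReal (Real.exp (-lam * s)) ≤ f x} ≤
      ENNReal.ofReal (Real.exp (-(c * ε * n / d))) := by
    refine (meas_ge_le_lintegral_div hfm.aemeasurable (by simp [Real.exp_pos]) (by simp)).trans ?_
    refine (ENNReal.div_le_div_right hexp _).trans ?_
    rw [← ENNReal.ofReal_div_of_pos (Real.exp_pos _), ← Real.exp_sub]
    refine ENNReal.ofReal_le_ofReal (Real.exp_le_exp.2 ?_)
    have h1 : (3 / 4 : ℝ) * (4 * s) ≤ (1 - 1 / (4 * (d : ℝ))) ^ d * ∑ r, ∑ i, A r i ^ 2 := by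
      have : 4 * s = ε * (n : ℝ) ^ d := by rw [hs]; ring
      rw [this]
      gcongr
    have h2 := mul_le_mul_of_nonneg_left h1 hlam0.le
    have h3 : lam * (2 * s) = 1 / (8 * D * Real.exp 1) * (ε * n / d) := by
      rw [hlam, hs, hκ]; field_simp; ring
    have h4 : c * ε * n / d ≤ lam * (2 * s) := by
      rw [h3, mul_assoc, mul_div_assoc]
      gcongr
    nlinarith
  have hsub : {x | gramForm A (tensorCoeff x) < s} ⊆
      {x | ENNReal.ofReal (Real.exp (-lam * s)) ≤ f x} ∪ Gᶜ := by
    intro x hx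
    by_cases hxG : x ∈ G
    · left
      have hx' : gramForm A (tensorCoeff x) < s := hx
      change _ ≤ f x
      rw [hf, Set.indicator_of_mem hxG]
      refine ENNReal.ofReal_le_ofReal (Real.exp_le_exp.2 ?_)
      nlinarith
    · exact Or.inr hxG
  refine (measure_mono hsub).trans ((measure_union_le _ _).trans ((add_le_add hmain hGc).trans ?_))
  rw [← ENNReal.ofReal_add (Real.exp_pos _).le (by positivity)]
  exact ENNReal.ofReal_le_ofReal (le_of_eq (by ring))

/-! ### From random tensors to product laws. -/

/-- The infimum need not be known to be attained: `K + 1` exceeds some admissible `t`, and it is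
positive even when `K = 0`. -/
lemma exists_of_psi2Norm_le {Ω : Type*} [MeasurableSpace Ω] {μ : Measure Ω} {K : ℝ≥0} {Y : Ω → ℝ}
    (h : psi2Norm μ Y ≤ K) :
    ∫⁻ ω, ENNReal.ofReal (Real.exp (Y ω ^ 2 / ((K : ℝ) + 1) ^ 2)) ∂μ ≤ 2 := by
  have hlt : psi2Norm μ Y < ENNReal.ofReal ((K : ℝ) + 1) := by
    refine h.trans_lt ?_
    rw [← ENNReal.ofReal_coe_nnreal]
    exact (ENNReal.ofReal_lt_ofReal_iff (by positivity)).2 (by linarith)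
  unfold psi2Norm at hlt
  simp only [iInf_lt_iff] at hlt
  obtain ⟨t, ⟨ht0, ht⟩, htK⟩ := hlt
  have htK' : t < (K : ℝ) + 1 := (ENNReal.ofReal_lt_ofReal_iff (by positivity)).1 htK
  refine le_trans (lintegral_mono fun ω => ENNReal.ofReal_le_ofReal (Real.exp_le_exp.2 ?_)) ht
  gcongr

lemma isUnitSubgaussian_map {Ω : Type*} [MeasurableSpace Ω] {μ : Measure Ω}
    [IsProbabilityMeasure μ] {K : ℝ≥0} {Y : Ω → ℝ} (hY : Measurable Y) (hmean : ∫ ω, Y ω ∂μ = 0)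
    (hvar : variance Y μ = 1) (hpsi : psi2Norm μ Y ≤ K) :
    IsUnitSubgaussian ((K : ℝ) + 1) (μ.map Y) := by
  have hmem : MemLp Y 2 μ := by
    -- Without a second moment `evariance` is `∞`, so `variance` would be `0` rather than `1`.
    by_contra hcon
    have h := evariance_eq_top hY.aestronglyMeasurable hcon
    rw [variance, h] at hvar
    simp at hvar
  refine ⟨Measure.isProbabilityMeasure_map hY.aemeasurable, ?_, ?_, ?_, ?_⟩
  · rw [memLp_map_measure_iff (by fun_prop) hY.aemeasurable]
    exact hmem
  · rw [integral_map hY.aemeasurable (by fun_prop)]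
    exact hmean
  · rw [integral_map hY.aemeasurable (by fun_prop), ← hvar,
      variance_of_integral_eq_zero hY.aemeasurable hmean]
  · rw [lintegral_map (by fun_prop) hY]
    exact exists_of_psi2Norm_le hpsi

/-- A simple subgaussian random tensor is measurable, and its law is the image of a product of
one-dimensional laws under the tensor product. -/
lemma IsSimpleSubgaussianTensor.exists_law {Ω : Type*} [MeasurableSpace Ω] {μ : Measure Ω}
    [IsProbabilityMeasure μ] {K : ℝ≥0} {d n : ℕ} {X : Ω → TensorSpace d n}
    (h : IsSimpleSubgaussianTensor μ K X) : Measurable X ∧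
    ∃ ν : Fin d → Fin n → Measure ℝ, (∀ k j, IsUnitSubgaussian ((K : ℝ) + 1) (ν k j)) ∧
      μ.map X = (Measure.pi fun k => Measure.pi (ν k)).map
        fun x => WithLp.toLp 2 (tensorCoeff x) := by
  obtain ⟨x, hxm, hind, hindc, hmean, hvar, hpsi, hX⟩ := h
  have hxm' : ∀ k j, Measurable fun ω => x k ω j := fun k j => by
    have := hxm k
    fun_prop
  set ν : Fin d → Fin n → Measure ℝ := fun k j => μ.map fun ω => x k ω j with hν
  have hνs : ∀ k j, IsUnitSubgaussian ((K : ℝ) + 1) (ν k j) := fun k j =>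
    isUnitSubgaussian_map (hxm' k j) (hmean k j) (hvar k j) (hpsi k j)
  set Y : Ω → Fin d → Fin n → ℝ := fun ω k j => x k ω j with hY
  have hYm : Measurable Y :=
    measurable_pi_lambda _ fun k => measurable_pi_lambda _ fun j => hxm' k j
  have hTm : Measurable fun x : Fin d → Fin n → ℝ =>
      (WithLp.toLp 2 (tensorCoeff x) : TensorSpace d n) :=
    (WithLp.measurable_toLp 2 _).comp (measurable_pi_lambda _ fun i => measurable_tensorCoeff i)
  have hXY : X = (fun x => WithLp.toLp 2 (tensorCoeff x)) ∘ Y := by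
    ext1 ω; rw [hX]; rfl
  refine ⟨hXY ▸ hTm.comp hYm, ν, hνs, ?_⟩
  have hlaw : μ.map Y = Measure.pi fun k => Measure.pi (ν k) := by
    have h1 : iIndepFun (fun k ω => fun j => x k ω j) μ :=
      hind.comp (fun _ v => v.ofLp) fun _ => WithLp.measurable_ofLp 2 _
    have h2 := (iIndepFun_iff_map_fun_eq_pi_map (fun k =>
      (measurable_pi_lambda _ fun j => hxm' k j).aemeasurable)).1 h1
    rw [hY, h2]
    congr 1
    ext1 k
    exact (iIndepFun_iff_map_fun_eq_pi_map fun j => (hxm' k j).aemeasurable).1 (hindc k)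
  rw [hXY, ← Measure.map_map hTm hYm, hlaw]

/-! ### Distance to the span of the other columns. -/

/-- The orthogonal projection away from the span of few vectors is given by a contraction with
large Hilbert–Schmidt norm. -/
lemma exists_gramForm_of_family {ι J : Type*} [Fintype ι] [Fintype J] (w : J → EuclideanSpace ℝ ι)
    {s : ℝ} (hs : s + Fintype.card J ≤ Fintype.card ι) :
    ∃ (r : ℕ) (A : Fin r → ι → ℝ), (∀ v, gramForm A v ≤ ∑ i, v i ^ 2) ∧
      s ≤ ∑ r, ∑ i, A r i ^ 2 ∧
      ∀ (v : EuclideanSpace ℝ ι) (b : J → ℝ), gramForm A v ≤ ‖v - ∑ j, b j • w j‖ ^ 2 := by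
  set W := Submodule.span ℝ (Set.range w) with hW
  set e := stdOrthonormalBasis ℝ Wᗮ with he
  have hon : Orthonormal ℝ fun r => (e r : EuclideanSpace ℝ ι) :=
    e.orthonormal.comp_linearIsometry Wᗮ.subtypeₗᵢ
  have hgram : ∀ v : EuclideanSpace ℝ ι, gramForm (fun r i => (e r : EuclideanSpace ℝ ι) i) v =
      ∑ r, ‖inner ℝ (e r : EuclideanSpace ℝ ι) v‖ ^ 2 := by
    intro v
    unfold gramForm
    refine Finset.sum_congr rfl fun r _ => ?_
    rw [Real.norm_eq_abs, sq_abs, PiLp.inner_apply]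
    simp [mul_comm]
  have hbes : ∀ v : EuclideanSpace ℝ ι,
      gramForm (fun r i => (e r : EuclideanSpace ℝ ι) i) v ≤ ‖v‖ ^ 2 := fun v => by
    rw [hgram]; exact hon.sum_inner_products_le v
  refine ⟨_, fun r i => (e r : EuclideanSpace ℝ ι) i, fun v => ?_, ?_, fun v b => ?_⟩
  · simpa [EuclideanSpace.real_norm_sq_eq] using hbes (WithLp.toLp 2 v)
  · have h1 : ∀ r, ∑ i, (e r : EuclideanSpace ℝ ι) i ^ 2 = 1 := fun r => by
      rw [← EuclideanSpace.real_norm_sq_eq, hon.1 r]; norm_num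
    simp_rw [h1]
    have h2 : Module.finrank ℝ W ≤ Fintype.card J := finrank_range_le_card w
    have h3 := W.finrank_add_finrank_orthogonal
    rw [finrank_euclideanSpace] at h3
    have h4 : (Module.finrank ℝ W : ℝ) + Module.finrank ℝ Wᗮ = Fintype.card ι := by
      exact_mod_cast h3
    have h5 : (Module.finrank ℝ W : ℝ) ≤ Fintype.card J := by exact_mod_cast h2
    simp
    linarith
  · refine le_trans (le_of_eq ?_) (hbes _)
    rw [hgram, hgram]
    refine Finset.sum_congr rfl fun r _ => ?_
    have hmem : ∑ j, b j • w j ∈ W :=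
      Submodule.sum_mem _ fun j _ => Submodule.smul_mem _ _ (Submodule.subset_span ⟨j, rfl⟩)
    rw [inner_sub_right, (Submodule.mem_orthogonal' _ _).1 (e r).2 _ hmem, sub_zero]

/-- If a linear combination is short then some vector is close to the span of the others. -/
lemma exists_norm_sub_sum_lt {E : Type*} [NormedAddCommGroup E] [NormedSpace ℝ E] {m : ℕ}
    {v : Fin m → E} {s : ℝ} (hs : 0 ≤ s) {a : EuclideanSpace ℝ (Fin m)}
    (ha : ‖∑ i, a i • v i‖ < s * ‖a‖) :
    ∃ i, ∃ b : {j // j ≠ i} → ℝ, ‖v i - ∑ j, b j • v j‖ < s * Real.sqrt m := by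
  have hapos : 0 < ‖a‖ := by
    rcases (norm_nonneg a).eq_or_lt with h | h
    · rw [← h, mul_zero] at ha; exact absurd ha (norm_nonneg _).not_gt
    · exact h
  have hne : Nonempty (Fin m) := by
    by_contra hcon
    rw [not_nonempty_iff] at hcon
    have : a = 0 := Subsingleton.elim _ _
    simp [this] at hapos
  -- The largest coefficient satisfies `‖a‖ ≤ √m |a i|`, which is the source of the factor `√m`.
  obtain ⟨i, hi⟩ := Finite.exists_max fun i => |a i|
  have hsq : ‖a‖ ^ 2 ≤ m * |a i| ^ 2 := by
    rw [EuclideanSpace.real_norm_sq_eq]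
    calc ∑ j, a j ^ 2 ≤ ∑ _j : Fin m, |a i| ^ 2 := Finset.sum_le_sum fun j _ => by
          rw [← sq_abs (a j)]
          exact pow_le_pow_left₀ (abs_nonneg _) (hi j) 2
      _ = _ := by simp
  have hle : ‖a‖ ≤ Real.sqrt m * |a i| := by
    refine le_of_sq_le_sq ?_ (by positivity)
    rw [mul_pow, Real.sq_sqrt (by positivity)]
    exact hsq
  have hai : 0 < |a i| := by
    rcases (abs_nonneg (a i)).eq_or_lt with h | h
    · rw [← h, mul_zero] at hle; linarith
    · exact h
  have hai' : a i ≠ 0 := abs_pos.1 hai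
  refine ⟨i, fun j => -(a i)⁻¹ * a j, ?_⟩
  have e : v i - ∑ j : {j // j ≠ i}, (-(a i)⁻¹ * a j) • v j = (a i)⁻¹ • ∑ j, a j • v j := by
    rw [← Finset.add_sum_erase _ _ (Finset.mem_univ i), smul_add, smul_smul, inv_mul_cancel₀ hai',
      one_smul, sub_eq_add_neg, ← Finset.sum_neg_distrib, Finset.smul_sum]
    congr 1
    rw [← Finset.sum_subtype (Finset.univ.erase i) (p := fun j => j ≠ i) (by simp)
      fun j => -((-(a i)⁻¹ * a j) • v j)]
    exact Finset.sum_congr rfl fun j _ => by rw [neg_mul, neg_smul, neg_neg, smul_smul]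
  rw [e, norm_smul, norm_inv, Real.norm_eq_abs, inv_mul_lt_iff₀ hai]
  calc _ < s * ‖a‖ := ha
    _ ≤ s * (Real.sqrt m * |a i|) := by gcongr
    _ = _ := by ring

/-- For independent `X` and `W`, an event about both is as likely as in the worst case for `W`. -/
lemma measure_preimage_prodMk_le {Ω E F : Type*} [MeasurableSpace Ω] [MeasurableSpace E]
    [MeasurableSpace F] {μ : Measure Ω} [IsProbabilityMeasure μ] {X : Ω → E} {W : Ω → F}
    (hX : Measurable X) (hW : Measurable W) (hind : IndepFun X W μ) {N : Set (E × F)}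
    (hN : MeasurableSet N) {p : ℝ≥0∞} (hp : ∀ w, μ.map X {v | (v, w) ∈ N} ≤ p) :
    μ {ω | (X ω, W ω) ∈ N} ≤ p := by
  have : IsProbabilityMeasure (μ.map X) := Measure.isProbabilityMeasure_map hX.aemeasurable
  have : IsProbabilityMeasure (μ.map W) := Measure.isProbabilityMeasure_map hW.aemeasurable
  have h := (indepFun_iff_map_prod_eq_prod_map_map hX.aemeasurable hW.aemeasurable).1 hind
  calc μ {ω | (X ω, W ω) ∈ N} = μ.map (fun ω => (X ω, W ω)) N :=
        (Measure.map_apply (hX.prodMk hW) hN).symm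
    _ = ∫⁻ w, μ.map X ((fun v => (v, w)) ⁻¹' N) ∂μ.map W := by
        rw [h, Measure.prod_apply_symm hN]
    _ ≤ ∫⁻ _, p ∂μ.map W := lintegral_mono hp
    _ = p := by simp

/-- Supplies measurability: the union over `b` is uncountable, but a union of open sets is open. -/
lemma isOpen_setOf_exists_norm_sub_sum_lt {E J : Type*} [NormedAddCommGroup E] [NormedSpace ℝ E]
    [Fintype J] (t : ℝ) :
    IsOpen {p : E × (J → E) | ∃ b : J → ℝ, ‖p.1 - ∑ j, b j • p.2 j‖ < t} := by
  have : {p : E × (J → E) | ∃ b : J → ℝ, ‖p.1 - ∑ j, b j • p.2 j‖ < t} =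
      ⋃ b : J → ℝ, {p : E × (J → E) | ‖p.1 - ∑ j, b j • p.2 j‖ < t} := by
    ext p; simp
  rw [this]
  exact isOpen_iUnion fun b => isOpen_lt (by fun_prop) continuous_const

/-! ### Union bound, singular values and choice of constants. -/

/-- Random tensors are well conditioned, with the union bound left explicit. -/
lemma exists_le_measureReal_norm_sum_ge (K : ℝ≥0) : ∃ c : ℝ, 0 < c ∧
    ∀ (Ω : Type*) [MeasurableSpace Ω] (μ : Measure Ω) [IsProbabilityMeasure μ]
      (n d m : ℕ) (_ : 0 < n) (_ : 0 < d) (ε : ℝ) (_ : 0 ≤ ε) (_ : ε ≤ 1)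
      (_ : (m : ℝ) ≤ (1 - ε) * (n : ℝ) ^ d) (X : Fin m → Ω → TensorSpace d n)
      (_ : ∀ i, IsSimpleSubgaussianTensor μ K (X i)) (_ : iIndepFun X μ),
      1 - m * ((1 + d) * Real.exp (-(c * ε * n / d))) ≤
        μ.real {ω | ∀ a : EuclideanSpace ℝ (Fin m),
          Real.sqrt ε / 2 * ‖a‖ ≤ ‖∑ i, a i • X i ω‖} := by
  obtain ⟨c, hc, H⟩ := exists_measure_gramForm_lt_le (L := (K : ℝ) + 1) (by positivity)
  refine ⟨c, hc, fun Ω _ μ _ n d m hn hd ε hε hε1 hm X hX hind => ?_⟩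
  have hXm : ∀ i, Measurable (X i) := fun i => (hX i).exists_law.1
  set p := (1 + d) * Real.exp (-(c * ε * n / d)) with hp
  have hp0 : 0 ≤ p := by positivity
  set t := Real.sqrt ε / 2 * Real.sqrt m with ht
  have hnd : (0 : ℝ) ≤ (n : ℝ) ^ d := by positivity
  have hmn : (m : ℝ) ≤ (n : ℝ) ^ d := by nlinarith
  have ht2 : t ^ 2 ≤ ε * (n : ℝ) ^ d / 4 := by
    rw [ht, mul_pow, div_pow, Real.sq_sqrt hε, Real.sq_sqrt (by positivity)]
    nlinarith
  have hcol : ∀ i, μ {ω | ∃ b : {j // j ≠ i} → ℝ, ‖X i ω - ∑ j, b j • X j ω‖ < t} ≤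
      ENNReal.ofReal p := by
    intro i
    set W : Ω → {j // j ≠ i} → TensorSpace d n := fun ω j => X j ω with hW
    have hWm : Measurable W := measurable_pi_lambda _ fun j => hXm j
    have hindep : IndepFun (X i) W μ := by
      have h := hind.indepFun_finset {i} (Finset.univ.erase i) (by simp) hXm
      have hφ : Measurable fun f : ({i} : Finset (Fin m)) → TensorSpace d n =>
          f ⟨i, Finset.mem_singleton_self i⟩ := measurable_pi_apply _
      have hψ : Measurable fun (f : Finset.univ.erase i → TensorSpace d n) (j : {j // j ≠ i}) =>
          f ⟨j, Finset.mem_erase.2 ⟨j.2, Finset.mem_univ _⟩⟩ :=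
        measurable_pi_lambda _ fun j => measurable_pi_apply _
      exact h.comp hφ hψ
    refine measure_preimage_prodMk_le (hXm i) hWm hindep
      (isOpen_setOf_exists_norm_sub_sum_lt t).measurableSet fun w => ?_
    obtain ⟨_, ν, hν, hlaw⟩ := (hX i).exists_law
    have hcard : (Fintype.card {j // j ≠ i} : ℝ) ≤ m := by
      have h := Fintype.card_subtype_le fun j : Fin m => j ≠ i
      rw [Fintype.card_fin] at h
      exact_mod_cast h
    obtain ⟨r, A, hA, hT, hdist⟩ := exists_gramForm_of_family w (s := ε * (n : ℝ) ^ d) (by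
      simp only [Fintype.card_fun, Fintype.card_fin, Nat.cast_pow]
      linarith)
    have hTm : Measurable fun x : Fin d → Fin n → ℝ =>
        (WithLp.toLp 2 (tensorCoeff x) : TensorSpace d n) :=
      (WithLp.measurable_toLp 2 _).comp (measurable_pi_lambda _ fun i => measurable_tensorCoeff i)
    have hms : MeasurableSet {v : TensorSpace d n | (v, w) ∈
        {p : TensorSpace d n × ({j // j ≠ i} → TensorSpace d n) |
          ∃ b : {j // j ≠ i} → ℝ, ‖p.1 - ∑ j, b j • p.2 j‖ < t}} :=
      measurable_prodMk_right (isOpen_setOf_exists_norm_sub_sum_lt t).measurableSet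
    rw [hlaw, Measure.map_apply hTm hms]
    refine (measure_mono ?_).trans (H n d hn hd ε hε hε1 (Fin r) A hA hT ν hν)
    rintro x ⟨b, hb⟩
    have h1 := hdist (WithLp.toLp 2 (tensorCoeff x)) b
    have h2 : ‖(WithLp.toLp 2 (tensorCoeff x) : TensorSpace d n) - ∑ j, b j • w j‖ ^ 2 < t ^ 2 :=
      pow_lt_pow_left₀ hb (norm_nonneg _) (by norm_num)
    exact lt_of_le_of_lt h1 (h2.trans_le ht2)
  set S := {ω | ∀ a : EuclideanSpace ℝ (Fin m),
    Real.sqrt ε / 2 * ‖a‖ ≤ ‖∑ i, a i • X i ω‖} with hS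
  have hSc : μ Sᶜ ≤ ENNReal.ofReal (m * p) := by
    have hsub : Sᶜ ⊆ ⋃ i, {ω | ∃ b : {j // j ≠ i} → ℝ, ‖X i ω - ∑ j, b j • X j ω‖ < t} := by
      intro ω hω
      have hω' : ¬ ∀ a : EuclideanSpace ℝ (Fin m),
        Real.sqrt ε / 2 * ‖a‖ ≤ ‖∑ i, a i • X i ω‖ := hω
      push Not at hω'
      obtain ⟨a, ha⟩ := hω'
      obtain ⟨i, b, hb⟩ := exists_norm_sub_sum_lt (v := fun i => X i ω) (by positivity) ha
      exact Set.mem_iUnion.2 ⟨i, b, hb⟩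
    refine (measure_mono hsub).trans ((measure_iUnion_fintype_le _ _).trans ?_)
    refine (Finset.sum_le_sum fun i _ => hcol i).trans ?_
    rw [ENNReal.ofReal_mul (Nat.cast_nonneg m), Finset.sum_const]
    simp only [Finset.card_univ, Fintype.card_fin, nsmul_eq_mul, ENNReal.ofReal_natCast, le_refl]
  have h1 : μ.real Sᶜ ≤ m * p := ENNReal.toReal_le_of_le_ofReal (by positivity) hSc
  have h2 : (1 : ℝ) ≤ μ.real S + μ.real Sᶜ := by
    have h := measureReal_union_le (μ := μ) S Sᶜ
    rwa [Set.union_compl_self, probReal_univ] at h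
  linarith

/-- The square of this singular value is an eigenvalue of `T* T`, so an eigenvector `v` has `‖T v‖ =
σ ‖v‖`. -/
lemma le_sigmaMin_khatriRao {d n m : ℕ} (hm : 0 < m) {X : Fin m → TensorSpace d n} {s : ℝ}
    (h : ∀ a : EuclideanSpace ℝ (Fin m), s * ‖a‖ ≤ ‖∑ i, a i • X i‖) :
    s ≤ sigmaMin (khatriRao X) := by
  unfold sigmaMin
  set T := Matrix.toEuclideanLin (khatriRao X) with hT
  have happ : ∀ a, T a = ∑ i, a i • X i := by
    intro a
    ext j
    simp [hT, Matrix.toLpLin_apply, Matrix.mulVec, dotProduct, khatriRao, mul_comm]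
  have hev := T.hasEigenvalue_adjoint_comp_self_sq_singularValues (n := m - 1) (by simp; omega)
  obtain ⟨v, hv⟩ := hev.exists_hasEigenvector
  have hv0 : 0 < ‖v‖ := norm_pos_iff.2 hv.2
  have hσ := T.singularValues_nonneg (m - 1)
  have hnorm : ‖T v‖ ^ 2 = (T.singularValues (m - 1) * ‖v‖) ^ 2 := by
    rw [← real_inner_self_eq_norm_sq, ← LinearMap.adjoint_inner_left]
    have h1 : LinearMap.adjoint T (T v) = T.singularValues (m - 1) ^ 2 • v := hv.apply_eq_smul
    rw [h1, real_inner_smul_left, real_inner_self_eq_norm_sq, mul_pow]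
  have h2 : ‖T v‖ = T.singularValues (m - 1) * ‖v‖ :=
    (pow_left_inj₀ (norm_nonneg _) (by positivity) two_ne_zero).1 hnorm
  have h3 := h v
  rw [← happ, h2] at h3
  exact le_of_mul_le_mul_right h3 hv0

/-- Random tensors are well conditioned, for all `ε ≤ 1`. -/
lemma exists_le_measureReal_norm_sum_ge_of_log_le (K : ℝ≥0) : ∃ C : ℝ, 0 < C ∧ ∃ c : ℝ, 0 < c ∧
    ∀ (Ω : Type*) [MeasurableSpace Ω] (μ : Measure Ω) [IsProbabilityMeasure μ]
      (n d m : ℕ) (_ : 0 < n) (_ : 0 < d) (ε : ℝ)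
      (_ : C * (d : ℝ) ^ 2 * Real.log n / n ≤ ε) (_ : ε ≤ 1)
      (_ : (m : ℝ) ≤ (1 - ε) * (n : ℝ) ^ d) (X : Fin m → Ω → TensorSpace d n)
      (_ : ∀ i, IsSimpleSubgaussianTensor μ K (X i)) (_ : iIndepFun X μ),
      1 - 2 * Real.exp (-(c * ε * n / d)) ≤
        μ.real {ω | ∀ a : EuclideanSpace ℝ (Fin m),
          Real.sqrt ε / 2 * ‖a‖ ≤ ‖∑ i, a i • X i ω‖} := by
  obtain ⟨c, hc, H⟩ := exists_le_measureReal_norm_sum_ge K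
  -- With `C = 4/c`, `n^d ≤ exp (c x / 4)` for `x = εn/d`. Both `m` and, for `n ≥ 2`, `1 + d` are at
  -- most `n^d`, so half of the exponent `c x` survives.
  refine ⟨4 / c, by positivity, c / 2, by positivity,
    fun Ω _ μ _ n d m hn hd ε hεC hε1 hm X hX hind => ?_⟩
  have hn' : (0 : ℝ) < n := by exact_mod_cast hn
  have hd' : (0 : ℝ) < d := by exact_mod_cast hd
  have hlog : 0 ≤ Real.log n := Real.log_natCast_nonneg n
  have hε : 0 ≤ ε := le_trans (by positivity) hεC
  have h := H Ω μ n d m hn hd ε hε hε1 hm X hX hind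
  rcases Nat.eq_zero_or_pos m with rfl | hm0
  · refine le_trans ?_ h
    simp [Real.exp_nonneg]
  have hm1 : (1 : ℝ) ≤ m := by exact_mod_cast hm0
  rcases Nat.lt_or_ge 1 n with hn1 | hn1
  · refine le_trans ?_ h
    have hn2 : (2 : ℝ) ≤ n := by exact_mod_cast hn1
    set x := ε * n / d with hx
    have e1 : c * ε * n / d = c * x := by rw [hx]; ring
    have e2 : c / 2 * ε * n / d = c / 2 * x := by rw [hx]; ring
    have hx1 : d * Real.log n ≤ c / 4 * x := by
      rw [div_mul_eq_mul_div, div_mul_eq_mul_div, div_div, div_le_iff₀ (by positivity)] at hεC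
      rw [hx, ← mul_div_assoc, le_div_iff₀ hd']
      nlinarith
    have hd2 : (1 + d : ℝ) ≤ (n : ℝ) ^ d := by
      have h2 := one_add_mul_le_pow (a := (1 : ℝ)) (by norm_num) d
      have h3 : (1 + 1 : ℝ) ^ d ≤ (n : ℝ) ^ d := by gcongr; linarith
      linarith
    have hmn : (m : ℝ) ≤ (n : ℝ) ^ d := by
      have : (0 : ℝ) ≤ (n : ℝ) ^ d := by positivity
      nlinarith
    have hpow : (n : ℝ) ^ d ≤ Real.exp (c / 4 * x) := by
      rw [← Real.exp_log hn', ← Real.exp_nat_mul]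
      exact Real.exp_le_exp.2 hx1
    have : m * ((1 + d) * Real.exp (-(c * x))) ≤ Real.exp (-(c / 2 * x)) := by
      calc m * ((1 + d) * Real.exp (-(c * x)))
          ≤ Real.exp (c / 4 * x) * (Real.exp (c / 4 * x) * Real.exp (-(c * x))) := by
            gcongr
            · exact hmn.trans hpow
            · exact hd2.trans hpow
        _ = Real.exp (-(c / 2 * x)) := by
            rw [← Real.exp_add, ← Real.exp_add]; ring_nf
    rw [e1, e2]
    linarith [Real.exp_pos (-(c / 2 * x))]
  -- Here `1 ≤ m ≤ 1 - ε` forces `ε = 0`, and the claimed probability bound is negative.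
  · have hn0 : n = 1 := by omega
    subst hn0
    have hε0 : ε = 0 := by
      simp at hm
      linarith
    subst hε0
    refine le_trans ?_ measureReal_nonneg
    simp

/-- The degree condition of the well-conditioned regime, for sequences of degrees that are
`o(√(n / log n))`. -/
lemma eventually_mul_sq_mul_log_div_le {d : ℕ → ℕ}
    (hd : (fun n => (d n : ℝ)) =o[atTop] fun n : ℕ => Real.sqrt (n / Real.log n)) {C ε : ℝ}
    (hC : 0 < C) (hε : 0 < ε) :
    ∀ᶠ n : ℕ in atTop, C * (d n : ℝ) ^ 2 * Real.log n / n ≤ ε := by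
  have h := hd.bound (c := Real.sqrt (ε / C)) (by positivity)
  filter_upwards [h, eventually_ge_atTop 2] with n hn hn2
  have hn2' : (2 : ℝ) ≤ n := by exact_mod_cast hn2
  have hn0 : (0 : ℝ) < n := by linarith
  have hlog : 0 < Real.log n := Real.log_pos (by linarith)
  rw [Real.norm_of_nonneg (Nat.cast_nonneg _), Real.norm_of_nonneg (Real.sqrt_nonneg _)] at hn
  have h2 := pow_le_pow_left₀ (Nat.cast_nonneg _) hn 2
  rw [mul_pow, Real.sq_sqrt (by positivity), Real.sq_sqrt (by positivity)] at h2
  calc C * (d n : ℝ) ^ 2 * Real.log n / n ≤ C * (ε / C * (n / Real.log n)) * Real.log n / n := by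
        gcongr
    _ = ε := by field_simp

theorem corollary6p2 (K : ℝ≥0) :
    (∃ C : ℝ, 0 < C ∧ ∃ c : ℝ, 0 < c ∧
      ∀ (Ω : Type*) [MeasurableSpace Ω] (μ : Measure Ω) [IsProbabilityMeasure μ]
        (n d m : ℕ) (_ : 0 < n) (_ : 0 < d) (ε : ℝ)
        (_ : C * (d : ℝ) ^ 2 * Real.log n / n ≤ ε) (_ : ε ≤ 1 / 2)
        (_ : (m : ℝ) ≤ (1 - ε) * (n : ℝ) ^ d)
        (X : Fin m → Ω → TensorSpace d n)
        (_ : ∀ i, IsSimpleSubgaussianTensor μ K (X i)) (_ : iIndepFun X μ),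
        1 - 2 * Real.exp (-(c * ε * n / d)) ≤
          μ.real {ω | ∀ a : EuclideanSpace ℝ (Fin m),
            Real.sqrt ε / 2 * ‖a‖ ≤ ‖∑ i, a i • X i ω‖}) ∧
    ∀ (ε : ℝ) (_ : 0 < ε) (_ : ε < 1) (d : ℕ → ℕ) (_ : ∀ n, 0 < d n)
      (_ : (fun n => (d n : ℝ)) =o[atTop] fun n : ℕ => Real.sqrt (n / Real.log n))
      (δ : ℝ) (_ : 0 < δ),
      ∀ᶠ n : ℕ in atTop,
        ∀ (Ω : Type*) [MeasurableSpace Ω] (μ : Measure Ω) [IsProbabilityMeasure μ]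
          (m : ℕ) (_ : 0 < m) (_ : (m : ℝ) ≤ (1 - ε) * (n : ℝ) ^ d n)
          (X : Fin m → Ω → TensorSpace (d n) n)
          (_ : ∀ i, IsSimpleSubgaussianTensor μ K (X i)) (_ : iIndepFun X μ),
          1 - δ ≤ μ.real {ω | Real.sqrt ε / 2 ≤ sigmaMin (khatriRao fun i => X i ω)} := by
  -- The two parts quantify over probability spaces in separate universes, hence two sets of
  -- constants.
  obtain ⟨C, hC, c, hc, H⟩ := exists_le_measureReal_norm_sum_ge_of_log_le.{u_1} K
  obtain ⟨C', hC', c', hc', H'⟩ := exists_le_measureReal_norm_sum_ge_of_log_le.{u_2} K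
  refine ⟨⟨C, hC, c, hc, fun Ω _ μ _ n d m hn hd ε hεC hε hm X hX hind =>
    H Ω μ n d m hn hd ε hεC (by linarith) hm X hX hind⟩, ?_⟩
  intro ε hε hε1 d hd hdo δ hδ
  have hlim : Tendsto (fun n : ℕ => 2 * Real.exp (-(c' * C' * Real.log n))) atTop (𝓝 0) := by
    have h1 : Tendsto (fun n : ℕ => c' * C' * Real.log n) atTop atTop :=
      (Real.tendsto_log_atTop.comp tendsto_natCast_atTop_atTop).const_mul_atTop (by positivity)
    simpa using (Real.tendsto_exp_neg_atTop_nhds_zero.comp h1).const_mul 2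
  filter_upwards [eventually_mul_sq_mul_log_div_le hdo hC' hε, hlim.eventually_lt_const hδ,
    eventually_gt_atTop 0] with n hn hnδ hn0
  intro Ω _ μ _ m hm0 hm X hX hind
  have h := H' Ω μ n (d n) m hn0 (hd n) ε hn hε1.le hm X hX hind
  have hn' : (0 : ℝ) < n := by exact_mod_cast hn0
  have hd1 : (1 : ℝ) ≤ d n := by exact_mod_cast hd n
  have hlog : 0 ≤ Real.log n := Real.log_natCast_nonneg n
  -- The degree condition gives `ε n / d ≥ C' d log n ≥ C' log n`, so the failure probability tends
  -- to `0` at a rate independent of `m` and the tensors.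
  have hexp : c' * C' * Real.log n ≤ c' * ε * n / d n := by
    rw [div_le_iff₀ hn'] at hn
    rw [le_div_iff₀ (by linarith)]
    have h1 : C' * d n * Real.log n ≤ C' * (d n : ℝ) ^ 2 * Real.log n := by
      gcongr
      nlinarith
    calc c' * C' * Real.log n * d n = c' * (C' * d n * Real.log n) := by ring
      _ ≤ c' * (ε * n) := mul_le_mul_of_nonneg_left (h1.trans hn) hc'.le
      _ = _ := by ring
  have hexp' : Real.exp (-(c' * ε * n / d n)) ≤ Real.exp (-(c' * C' * Real.log n)) :=
    Real.exp_le_exp.2 (neg_le_neg hexp)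
  refine le_trans (by linarith) (h.trans (measureReal_mono fun ω hω => ?_))
  exact le_sigmaMin_khatriRao hm0 hω
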